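/- **Definitions.** An arithmetic circuit over $\mathbb{Q}[x_1,\dots,x_m]$ is a finite directed acyclic graph whose input gates are labelled by a variable $x_j$ or a constant from $\{-1,0,1\}$ and whose other gates have fan-in $2$ and are labelled $+$ or $\times$; a circuit may have several ordered output gates, and then computes the vector of the polynomials at these gates. Its size is the number of vertices, its depth the length of a longest path. A parametric Markov chain (pMC) $\mathcal{M}$ with states $1,\dots,n$ and parameters $x_1,\dots,x_m$ is given by polynomials $p_{ij}\in\mathbb{Q}[x_1,\dots,x_m]$, $1\le i,j\le n$. A valuation $v\in\mathbb{R}^m$ is graph preserving if $0<p_{ij}(v)\le 1$ whenever $p_{ij}\not\equiv 0$, and $\sum_{k}p_{ik}(v)=1$ for all $i$. We assume that $n\ge 2$, that $\mathcal{M}$ has at least one graph-preserving valuation, and that, in the graph with an edge $i\to j$ whenever $p_{ij}\not\equiv0$, state $n-1$ is the only state from which the target state $n$ is not reachable. The size of $\mathcal{M}$ is $$|\mathcal{M}|=\sum_{i,j}|\mathrm{supp}(p_{ij})|\cdot\max(\deg p_{ij},1)\cdot \mathrm{bits}(p_{ij}),$$ where $|\mathrm{supp}(f)|$ is the number of monomials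 of $f$ with nonzero coefficient, and $\mathrm{bits}(f)$ is the number of binary digits of the largest absolute value of a numerator or denominator of a coefficient of $f$ in lowest terms. Put $d=\max_{i,j}\deg p_{ij}$ (total degree). The value functions $g_1,\dots,g_n\in\mathbb{Q}(x_1,\dots,x_m)$ are the solution of $(I_n-A)\,y=(0,\dots,0,1)^{\mathsf T}$, where $A_{ij}=p_{ij}$ for $i<n-1$ and $A_{ij}=0$ for $i\in\{n-1,n\}$. **Theorem.** There is an absolute constant $K$ such that the following holds for every pMC $\mathcal{M}$ as above. The value functions $g_1,\dots,g_n$ exist and are unique, and there are two families of circuits $\mathcal{N}_i,\mathcal{D}_i$ ($1\le i\le n$) over $\mathbb{Q}[x_1,\dots,x_m]$, each with $m+1$ ordered outputs, of size at most $|\mathcal{M}|^{K}$ and depth at most $K\cdot\log_2|\mathcal{M}|\cdot\log_2(n\max(d,1))$, such that no output of $\mathcal{D}_i$ is the zero polynomial and the componentwise quotient of the outputs of $\mathcal{N}_i$ and $\mathcal{D}_i$ is $$\Bigl(g_i,\ \frac{\partial g_i}{\partial x_1},\ \dots,\ \frac{\partial g_i}{\partial x_m}\Bigr)\qquad\text{for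 all }1\le i\le n.$$ -/

import Mathlib

open MvPolynomial

/-! ### Polynomials and rational functions -/

/-- The field `ℚ(x₁, …, x_m)` of rational functions. -/
abbrev RatFun (m : ℕ) : Type := FractionRing (MvPolynomial (Fin m) ℚ)

/-- A polynomial, viewed as a rational function. -/
noncomputable abbrev polyToRat {m : ℕ} (p : MvPolynomial (Fin m) ℚ) : RatFun m :=
  algebraMap (MvPolynomial (Fin m) ℚ) (RatFun m) p

/-- The formal partial derivative `∂f/∂x_j` of a rational function `f = a / b`, that is,
`((∂a/∂x_j) b - a (∂b/∂x_j)) / b²`. By `ratPDeriv_div` the choice of `a` and `b` is immaterial. -/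
noncomputable def ratPDeriv {m : ℕ} (j : Fin m) (f : RatFun m) : RatFun m :=
  let a : MvPolynomial (Fin m) ℚ := IsFractionRing.num (MvPolynomial (Fin m) ℚ) f
  let b : MvPolynomial (Fin m) ℚ := IsFractionRing.den (MvPolynomial (Fin m) ℚ) f
  polyToRat (pderiv j a * b - a * pderiv j b) / polyToRat (b ^ 2)

theorem ratPDeriv_div {m : ℕ} (j : Fin m) (p q : MvPolynomial (Fin m) ℚ) (hq : q ≠ 0) :
    ratPDeriv j (polyToRat p / polyToRat q)
      = polyToRat (pderiv j p * q - p * pderiv j q) / polyToRat (q ^ 2) := by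
  have inj := IsFractionRing.injective (MvPolynomial (Fin m) ℚ) (RatFun m)
  have hne : ∀ r : MvPolynomial (Fin m) ℚ, r ≠ 0 → polyToRat r ≠ 0 := fun r hr h =>
    hr (inj (by simpa using h))
  simp only [ratPDeriv]
  generalize hf : polyToRat p / polyToRat q = f
  set a : MvPolynomial (Fin m) ℚ := IsFractionRing.num (MvPolynomial (Fin m) ℚ) f with ha
  have hb0 : ((IsFractionRing.den (MvPolynomial (Fin m) ℚ) f : MvPolynomial (Fin m) ℚ)) ≠ 0 :=
    nonZeroDivisors.coe_ne_zero _
  have hab : polyToRat a / polyToRat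
      (IsFractionRing.den (MvPolynomial (Fin m) ℚ) f : MvPolynomial (Fin m) ℚ) = f :=
    IsFractionRing.mk'_num_den' (MvPolynomial (Fin m) ℚ) f
  generalize (IsFractionRing.den (MvPolynomial (Fin m) ℚ) f : MvPolynomial (Fin m) ℚ) = b
    at hb0 hab ⊢
  clear_value a
  have hcross : a * q = p * b := by
    apply inj
    rw [← hf, div_eq_div_iff (hne _ hb0) (hne _ hq)] at hab
    simpa using hab
  have hd := congrArg (pderiv j) hcross
  simp only [Derivation.leibniz, smul_eq_mul] at hd
  rw [div_eq_div_iff (hne _ (pow_ne_zero 2 hb0)) (hne _ (pow_ne_zero 2 hq))]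
  simp only [polyToRat, ← map_mul]
  congr 1
  linear_combination (q * b) * hd - (b * pderiv j q + q * pderiv j b) * hcross

/-! ### Arithmetic circuits -/

/-- The label of a vertex of a circuit whose vertex set is `V`: an input gate carries a variable or
a constant from `{-1, 0, 1}`; a computation gate carries `+` or `×` and its two incoming edges,
here given by their source vertices. -/
inductive Gate (m : ℕ) (V : Type) : Type
  | var (i : Fin m) : Gate m V
  | const (c : SignType) : Gate m V
  | add (u w : V) : Gate m V
  | mul (u w : V) : Gate m V

/-- `g.Uses u`: there is an edge from `u` into the gate `g`. -/
def Gate.Uses {m : ℕ} {V : Type} : Gate m V → V → Prop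
  | .var _, _ => False
  | .const _, _ => False
  | .add u w, x => x = u ∨ x = w
  | .mul u w, x => x = u ∨ x = w

/-- An arithmetic circuit over `ℚ[x₁, …, x_m]` with `k` ordered output gates: a finite directed
acyclic graph of gates. -/
structure Circuit (m k : ℕ) where
  V : Type
  fintypeV : Fintype V
  gate : V → Gate m V
  acyclic : WellFounded (fun u v : V => (gate v).Uses u)
  output : Fin k → V

namespace Circuit

variable {m k : ℕ}

/-- The number of vertices. -/
def size (C : Circuit m k) : ℕ := @Fintype.card C.V C.fintypeV

/-- The polynomial computed at a vertex. -/
noncomputable def sem (C : Circuit m k) : C.V → MvPolynomial (Fin m) ℚ :=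
  C.acyclic.fix fun v ih =>
    match h : C.gate v with
    | .var i => X i
    | .const c => (c : MvPolynomial (Fin m) ℚ)
    | .add u w => ih u (by simp [h, Gate.Uses]) + ih w (by simp [h, Gate.Uses])
    | .mul u w => ih u (by simp [h, Gate.Uses]) * ih w (by simp [h, Gate.Uses])

/-- The length (number of edges) of a longest path that ends in a given vertex. -/
noncomputable def depthAt (C : Circuit m k) : C.V → ℕ :=
  C.acyclic.fix fun v ih =>
    match h : C.gate v with
    | .var _ => 0
    | .const _ => 0
    | .add u w => max (ih u (by simp [h, Gate.Uses])) (ih w (by simp [h, Gate.Uses])) + 1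
    | .mul u w => max (ih u (by simp [h, Gate.Uses])) (ih w (by simp [h, Gate.Uses])) + 1

/-- The length of a longest path in the circuit. -/
noncomputable def depth (C : Circuit m k) : ℕ :=
  (@Finset.univ C.V C.fintypeV).sup C.depthAt

/-- The vector of polynomials computed at the output gates. -/
noncomputable def outputs (C : Circuit m k) (l : Fin k) : MvPolynomial (Fin m) ℚ :=
  C.sem (C.output l)

theorem sem_eq (C : Circuit m k) (v : C.V) :
    C.sem v = match C.gate v with
      | .var i => X i
      | .const c => (c : MvPolynomial (Fin m) ℚ)
      | .add u w => C.sem u + C.sem w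
      | .mul u w => C.sem u * C.sem w := by
  conv_lhs => rw [sem, WellFounded.fix_eq]
  split <;> (rename_i h; simp only [h]; try rfl)

theorem depthAt_eq (C : Circuit m k) (v : C.V) :
    C.depthAt v = match C.gate v with
      | .var _ => 0
      | .const _ => 0
      | .add u w => max (C.depthAt u) (C.depthAt w) + 1
      | .mul u w => max (C.depthAt u) (C.depthAt w) + 1 := by
  conv_lhs => rw [depthAt, WellFounded.fix_eq]
  split <;> (rename_i h; simp only [h]; try rfl)

end Circuit

/-! ### Parametric Markov chains -/

/-- The largest numerator or denominator, in absolute value, of a coefficient of `f` in lowest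
terms (`0` for `f = 0`). -/
def coeffMax {m : ℕ} (f : MvPolynomial (Fin m) ℚ) : ℕ :=
  f.support.sup fun α => max (f.coeff α).num.natAbs (f.coeff α).den

/-- The representation size of `f`: number of monomials, times degree (unary exponents, at least 1),
times the number of binary digits of the largest coefficient component. -/
def repSize {m : ℕ} (f : MvPolynomial (Fin m) ℚ) : ℕ :=
  f.support.card * max f.totalDegree 1 * (Nat.log 2 (coeffMax f) + 1)

/-- A parametric Markov chain with states `0, …, n - 1` and parameters `x₀, …, x_{m-1}`. -/
structure PMC (n m : ℕ) where
  P : Fin n → Fin n → MvPolynomial (Fin m) ℚ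

namespace PMC

variable {n m : ℕ}

/-- A valuation is graph preserving if all nonzero entries take values in `(0, 1]` and all rows sum
to `1`. -/
def GraphPreserving (M : PMC n m) (v : Fin m → ℝ) : Prop :=
  (∀ i j, M.P i j ≠ 0 → 0 < aeval v (M.P i j) ∧ aeval v (M.P i j) ≤ 1) ∧
    ∀ i, ∑ j, aeval v (M.P i j) = 1

/-- The edges of the underlying graph. -/
def Edge (M : PMC n m) (i j : Fin n) : Prop := M.P i j ≠ 0

/-- There are at least two states, the last one is the target, and the last but one is the only
state from which the target is not reachable (reachability in zero steps counts). -/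
def Normalized (M : PMC n m) : Prop :=
  ∃ hn : 2 ≤ n, ∀ i : Fin n,
    ¬ Relation.ReflTransGen M.Edge i ⟨n - 1, by omega⟩ ↔ i = ⟨n - 2, by omega⟩

/-- The matrix `A`: the transition matrix with the rows of the last two states set to zero. -/
noncomputable def transMatrix (M : PMC n m) : Matrix (Fin n) (Fin n) (RatFun m) :=
  Matrix.of fun i j => if i.val + 2 < n then polyToRat (M.P i j) else 0

/-- `g` is a vector of value functions: `(I - A) g = (0, …, 0, 1)ᵀ`. -/
def IsValueFunctions (M : PMC n m) (g : Fin n → RatFun m) : Prop :=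
  Matrix.mulVec (1 - M.transMatrix) g = fun i => if i.val + 1 = n then 1 else 0

/-- The largest total degree of a transition polynomial. -/
noncomputable def maxDegree (M : PMC n m) : ℕ :=
  Finset.univ.sup fun i => Finset.univ.sup fun j => (M.P i j).totalDegree

/-- The size of the chain. -/
def size (M : PMC n m) : ℕ := ∑ i, ∑ j, repSize (M.P i j)

end PMC

/-! ### Derivations in levels -/

/-- `Chain St S d U`: the elements of `U` can be produced from the elements of `S` in `d` rounds,
where `St A x` means that `x` is the result of one operation on elements of `A`. -/
inductive Chain {α : Type*} (St : Set α → α → Prop) (S : Set α) : ℕ → Finset α → Prop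
  | zero : Chain St S 0 ∅
  | succ {d : ℕ} {U W : Finset α} : Chain St S d U → U ⊆ W →
      (∀ f ∈ W, f ∈ U ∨ St (S ∪ U) f) → Chain St S (d + 1) W

/-- `Der St S T d c`: all elements of `T` can be produced from `S` in `d` rounds that produce at most
`c` elements altogether. -/
def Der {α : Type*} (St : Set α → α → Prop) (S T : Set α) (d c : ℕ) : Prop :=
  ∃ U : Finset α, Chain St S d U ∧ U.card ≤ c ∧ T ⊆ S ∪ U

/-- One-step relations that are monotone in the set of available elements. -/
def MonoStep {α : Type*} (St : Set α → α → Prop) : Prop :=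
  ∀ ⦃A B : Set α⦄, A ⊆ B → ∀ x, St A x → St B x

section Chain

variable {α : Type*} {St : Set α → α → Prop} {S S' T T' : Set α} {d d' c c' : ℕ}

theorem Chain.base_mono (hSt : MonoStep St) (h : S ⊆ S') {U : Finset α} (hU : Chain St S d U) :
    Chain St S' d U := by
  induction hU with
  | zero => exact .zero
  | succ _ hsub hst ih =>
    exact .succ ih hsub fun f hf => (hst f hf).imp id
      (hSt (Set.union_subset_union_left _ h) f)

theorem Chain.depth_mono {U : Finset α} (hU : Chain St S d U) (h : d ≤ d') : Chain St S d' U := by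
  induction h with
  | refl => exact hU
  | step _ ih => exact .succ ih (Finset.Subset.refl _) fun f hf => Or.inl hf

theorem Chain.union [DecidableEq α] (hSt : MonoStep St) {U V : Finset α} (hU : Chain St S d U)
    (hV : Chain St S d V) : Chain St S d (U ∪ V) := by
  induction hU generalizing V with
  | zero => cases hV; exact .zero
  | succ hU hsub hst ih =>
    cases hV with
    | succ hV hsub' hst' =>
      refine .succ (ih hV) (Finset.union_subset_union hsub hsub') fun f hf => ?_
      rcases Finset.mem_union.1 hf with hf | hf
      · refine (hst f hf).imp (fun h => Finset.mem_union_left _ h) (hSt ?_ f)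
        gcongr
        exact Finset.subset_union_left
      · refine (hst' f hf).imp (fun h => Finset.mem_union_right _ h) (hSt ?_ f)
        gcongr
        exact Finset.subset_union_right

theorem Chain.trans [DecidableEq α] (hSt : MonoStep St) {U V : Finset α} (hU : Chain St S d U)
    (hV : Chain St (S ∪ U) d' V) : Chain St S (d + d') (U ∪ V) := by
  induction hV with
  | zero => simpa using hU
  | succ _ hsub hst ih =>
    refine .succ ih (Finset.union_subset_union_right hsub) fun f hf => ?_
    rcases Finset.mem_union.1 hf with hf | hf
    · exact Or.inl (Finset.mem_union_left _ hf)
    · refine (hst f hf).imp (fun h => Finset.mem_union_right _ h) (hSt ?_ f)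
      simp [Set.union_assoc]

theorem Der.of_subset (h : T ⊆ S) : Der St S T 0 0 :=
  ⟨∅, .zero, by simp, by simpa using h⟩

theorem Der.mono (h : Der St S T d c) (hd : d ≤ d') (hc : c ≤ c') : Der St S T d' c' := by
  obtain ⟨U, hU, hcard, hT⟩ := h
  exact ⟨U, hU.depth_mono hd, hcard.trans hc, hT⟩

theorem Der.subset (h : Der St S T d c) (hT : T' ⊆ T) : Der St S T' d c := by
  obtain ⟨U, hU, hcard, hT'⟩ := h
  exact ⟨U, hU, hcard, hT.trans hT'⟩

theorem Der.base_mono (hSt : MonoStep St) (h : Der St S T d c) (hS : S ⊆ S') :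
    Der St S' T d c := by
  obtain ⟨U, hU, hcard, hT⟩ := h
  exact ⟨U, hU.base_mono hSt hS, hcard, hT.trans (Set.union_subset_union_left _ hS)⟩

theorem Der.trans (hSt : MonoStep St) (h : Der St S T d c) (h' : Der St (S ∪ T) T' d' c') :
    Der St S (T ∪ T') (d + d') (c + c') := by
  classical
  obtain ⟨U, hU, hcard, hT⟩ := h
  obtain ⟨V, hV, hcard', hT'⟩ := h'
  have hsub : S ∪ T ⊆ S ∪ U := Set.union_subset Set.subset_union_left hT
  refine ⟨U ∪ V, hU.trans hSt (hV.base_mono hSt hsub),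
    (Finset.card_union_le _ _).trans (add_le_add hcard hcard'), ?_⟩
  rw [Finset.coe_union, ← Set.union_assoc]
  exact Set.union_subset (hT.trans Set.subset_union_left)
    (hT'.trans (Set.union_subset_union_left _ hsub))

theorem Der.trans_right (hSt : MonoStep St) (h : Der St S T d c)
    (h' : Der St (S ∪ T) T' d' c') : Der St S T' (d + d') (c + c') :=
  (h.trans hSt h').subset Set.subset_union_right

theorem Der.union (hSt : MonoStep St) (h : Der St S T d c) (h' : Der St S T' d c') :
    Der St S (T ∪ T') d (c + c') := by
  classical
  obtain ⟨U, hU, hcard, hT⟩ := h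
  obtain ⟨V, hV, hcard', hT'⟩ := h'
  refine ⟨U ∪ V, hU.union hSt hV, (Finset.card_union_le _ _).trans (add_le_add hcard hcard'), ?_⟩
  rw [Finset.coe_union]
  exact Set.union_subset (hT.trans (by gcongr; exact Set.subset_union_left))
    (hT'.trans (by gcongr; exact Set.subset_union_right))

theorem Der.biUnion (hSt : MonoStep St) {ι : Type*} (I : Finset ι) {F : ι → Set α}
    (h : ∀ i ∈ I, Der St S (F i) d c) : Der St S (⋃ i ∈ I, F i) d (I.card * c) := by
  classical
  induction I using Finset.induction_on with
  | empty =>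
    exact (Der.of_subset (by simp)).mono (Nat.zero_le _) (Nat.zero_le _)
  | insert a I ha ih =>
    rw [Finset.card_insert_of_notMem ha, Finset.set_biUnion_insert, add_mul, one_mul, add_comm]
    exact (h a (Finset.mem_insert_self _ _)).union hSt
      (ih fun i hi => h i (Finset.mem_insert_of_mem hi))

theorem Der.range (hSt : MonoStep St) {ι : Type*} [Fintype ι] {f : ι → α}
    (h : ∀ i, Der St S {f i} d c) : Der St S (Set.range f) d (Fintype.card ι * c) := by
  refine (Der.biUnion hSt Finset.univ fun i _ => h i).subset ?_
  rintro _ ⟨i, rfl⟩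
  simp

theorem Der.step (x : α) (h : St S x) : Der St S {x} 1 1 := by
  refine ⟨{x}, .succ .zero (by simp) (fun f hf => Or.inr ?_), by simp, by simp⟩
  rw [Finset.mem_singleton.1 hf]
  simpa using h

/-- Every element of a chain has a level, and is produced from elements of smaller level. -/
theorem Chain.exists_level (hSt : MonoStep St) {U : Finset α} (hU : Chain St S d U) :
    ∃ lev : α → ℕ, (∀ x ∈ S, lev x = 0) ∧ (∀ x ∈ U, lev x ≤ d) ∧
      ∀ x ∈ U, x ∉ S → St {y | (y ∈ S ∨ y ∈ U) ∧ lev y < lev x} x := by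
  classical
  induction hU with
  | zero => exact ⟨fun _ => 0, by simp, by simp, by simp⟩
  | @succ d U W _ hsub hst ih =>
    obtain ⟨lev, h0, hle, hlev⟩ := ih
    have hle' : ∀ x, x ∈ S ∨ x ∈ U → lev x ≤ d := by
      rintro x (hx | hx)
      · simp [h0 x hx]
      · exact hle x hx
    refine ⟨fun x => if x ∈ S ∨ x ∈ U then lev x else d + 1, fun x hx => by simp [hx, h0 x hx],
      fun x _ => ?_, fun x hx hxS => ?_⟩
    · dsimp only
      split_ifs with h
      · exact (hle' x h).trans (Nat.le_succ d)
      · exact le_rfl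
    · by_cases hxU : x ∈ U
      · refine hSt ?_ x (hlev x hxU hxS)
        rintro y ⟨hy, hyx⟩
        simp only [Set.mem_ofPred_eq, hy, hxU, or_true, if_true]
        exact ⟨hy.imp id (fun h => hsub h), hyx⟩
      · refine hSt ?_ x ((hst x hx).resolve_left hxU)
        intro y hy
        replace hy : y ∈ S ∨ y ∈ U := by simpa using hy
        simp only [Set.mem_ofPred_eq, hy, hxU, hxS, or_self, if_true, if_false]
        exact ⟨hy.imp id (fun h => hsub h), Nat.lt_succ_of_le (hle' y hy)⟩

end Chain

/-! ### Ring operations and field operations -/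

/-- One addition or multiplication. -/
inductive RingStep {R : Type*} [Add R] [Mul R] (S : Set R) : R → Prop
  | add {a b : R} : a ∈ S → b ∈ S → RingStep S (a + b)
  | mul {a b : R} : a ∈ S → b ∈ S → RingStep S (a * b)

/-- One addition, multiplication or inversion. -/
inductive FieldStep {K : Type*} [Field K] (S : Set K) : K → Prop
  | add {a b : K} : a ∈ S → b ∈ S → FieldStep S (a + b)
  | mul {a b : K} : a ∈ S → b ∈ S → FieldStep S (a * b)
  | inv {a : K} : a ∈ S → FieldStep S a⁻¹

theorem monoStep_ringStep {R : Type*} [Add R] [Mul R] : MonoStep (RingStep (R := R)) := by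
  rintro A B h _ (⟨ha, hb⟩ | ⟨ha, hb⟩)
  exacts [.add (h ha) (h hb), .mul (h ha) (h hb)]

theorem monoStep_fieldStep {K : Type*} [Field K] : MonoStep (FieldStep (K := K)) := by
  rintro A B h _ (⟨ha, hb⟩ | ⟨ha, hb⟩ | ha)
  exacts [.add (h ha) (h hb), .mul (h ha) (h hb), .inv (h ha)]

/-! ### From field operations to ring operations, and to circuits -/

section Fractions

variable {R K : Type*} [CommRing R] [IsDomain R] [Field K] [Algebra R K] [IsFractionRing R K]

/-- One field operation on fractions costs at most four ring operations, in two rounds. -/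
theorem FieldStep.exists_fraction {A : Set K} {T : Set R} (h0 : (0 : R) ∈ T) (h1 : (1 : R) ∈ T)
    (hA : ∀ f ∈ A, ∃ a ∈ T, ∃ b ∈ T, b ≠ 0 ∧ f = algebraMap R K a / algebraMap R K b)
    {x : K} (hx : FieldStep A x) :
    ∃ a b : R, Der RingStep T {a, b} 2 4 ∧ b ≠ 0 ∧ x = algebraMap R K a / algebraMap R K b := by
  have hne : ∀ r : R, r ≠ 0 → algebraMap R K r ≠ 0 := fun r hr h =>
    hr (IsFractionRing.injective R K (by simpa using h))
  have hmul : ∀ {a b : R} {S : Set R}, a ∈ S → b ∈ S → Der RingStep S {a * b} 1 1 := fun ha hb =>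
    Der.step _ (.mul ha hb)
  cases hx with
  | @add f g hf hg =>
    obtain ⟨a, ha, b, hb, hb0, rfl⟩ := hA f hf
    obtain ⟨a', ha', b', hb', hb0', rfl⟩ := hA g hg
    refine ⟨a * b' + b * a', b * b', ?_, mul_ne_zero hb0 hb0', ?_⟩
    · have h := ((hmul ha hb').union monoStep_ringStep (hmul hb ha')).union monoStep_ringStep
        (hmul hb hb')
      refine (h.trans monoStep_ringStep
        (Der.step (a * b' + b * a') (.add ?_ ?_))).subset ?_ <;>
      simp [Set.insert_subset_iff]
    · rw [div_add_div _ _ (hne _ hb0) (hne _ hb0')]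
      simp
  | @mul f g hf hg =>
    obtain ⟨a, ha, b, hb, hb0, rfl⟩ := hA f hf
    obtain ⟨a', ha', b', hb', hb0', rfl⟩ := hA g hg
    refine ⟨a * a', b * b', ?_, mul_ne_zero hb0 hb0', ?_⟩
    · exact ((hmul ha ha').union monoStep_ringStep (hmul hb hb')).mono (by simp) (by simp)
    · rw [div_mul_div_comm]
      simp
  | @inv f hf =>
    obtain ⟨a, ha, b, hb, hb0, rfl⟩ := hA f hf
    by_cases ha0 : a = 0
    · exact ⟨0, 1, (Der.of_subset (by simp [Set.insert_subset_iff, *])).mono (by simp) (by simp),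
        one_ne_zero, by simp [ha0]⟩
    · exact ⟨b, a, (Der.of_subset (by simp [Set.insert_subset_iff, *])).mono (by simp) (by simp),
        ha0, by simp⟩

theorem Chain.exists_fractions {B : Set R} (h0 : (0 : R) ∈ B) (h1 : (1 : R) ∈ B) {S : Set K}
    (hS : S ⊆ algebraMap R K '' B) {d : ℕ} {U : Finset K} (hU : Chain FieldStep S d U) :
    ∃ T : Set R, B ⊆ T ∧ Der RingStep B T (2 * d) (4 * U.card) ∧
      ∀ f, f ∈ S ∨ f ∈ U → ∃ a ∈ T, ∃ b ∈ T, b ≠ 0 ∧ f = algebraMap R K a / algebraMap R K b := by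
  classical
  induction hU with
  | zero =>
    refine ⟨B, subset_rfl, Der.of_subset subset_rfl, fun f hf => ?_⟩
    obtain ⟨a, ha, rfl⟩ := hS (by simpa using hf)
    exact ⟨a, ha, 1, h1, one_ne_zero, by simp⟩
  | @succ d U W _ hsub hst ih =>
    obtain ⟨T, hBT, hT, hfrac⟩ := ih
    have key : ∀ f ∈ W \ U, ∃ p : R × R, Der RingStep T {p.1, p.2} 2 4 ∧ p.2 ≠ 0 ∧
        f = algebraMap R K p.1 / algebraMap R K p.2 := by
      intro f hf
      rw [Finset.mem_sdiff] at hf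
      obtain ⟨a, b, h⟩ := FieldStep.exists_fraction (hBT h0) (hBT h1)
        (fun g hg => hfrac g (by simpa using hg)) ((hst f hf.1).resolve_left hf.2)
      exact ⟨(a, b), h⟩
    choose! p hp using key
    refine ⟨T ∪ ⋃ f ∈ W \ U, {(p f).1, (p f).2}, hBT.trans Set.subset_union_left,
      ((hT.trans monoStep_ringStep ((Der.biUnion monoStep_ringStep (W \ U)
        (F := fun f => {(p f).1, (p f).2}) (fun f hf => (hp f hf).1)).base_mono
          monoStep_ringStep Set.subset_union_right))).mono (by omega) ?_, ?_⟩
    · have := Finset.card_sdiff_add_card_eq_card hsub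
      omega
    · intro f hf
      by_cases hf' : f ∈ S ∨ f ∈ U
      · obtain ⟨a, ha, b, hb, h⟩ := hfrac f hf'
        exact ⟨a, Or.inl ha, b, Or.inl hb, h⟩
      · have hfW : f ∈ W \ U := by
          rw [Finset.mem_sdiff]
          tauto
        refine ⟨(p f).1, Or.inr ?_, (p f).2, Or.inr ?_, (hp f hfW).2⟩ <;>
        · simp only [Set.mem_iUnion]
          exact ⟨f, hfW, by simp⟩

end Fractions

/-- The elements of a chain are the vertices of a circuit, each of which computes itself. -/
theorem Circuit.exists_of_chain {m k : ℕ} (B : Finset (MvPolynomial (Fin m) ℚ))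
    (hB : ∀ x ∈ B, (∃ i, x = X i) ∨ ∃ c : SignType, x = (c : MvPolynomial (Fin m) ℚ))
    {d : ℕ} {U : Finset (MvPolynomial (Fin m) ℚ)}
    (hU : Chain RingStep (B : Set (MvPolynomial (Fin m) ℚ)) d U) :
    ∃ (V : Type) (_ : Fintype V) (gate : V → Gate m V)
      (acyclic : WellFounded fun u v : V => (gate v).Uses u) (val : V → MvPolynomial (Fin m) ℚ),
      Fintype.card V ≤ B.card + U.card ∧
      (∀ x, x ∈ B ∨ x ∈ U → ∃ v, val v = x) ∧
      ∀ out : Fin k → V, ∀ C : Circuit m k, C = ⟨V, ‹_›, gate, acyclic, out⟩ →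
        C.depth ≤ d ∧ ∀ l, C.outputs l = val (out l) := by
  classical
  obtain ⟨lev, h0, hle, hlev⟩ := hU.exists_level monoStep_ringStep
  let V : Type := {x // x ∈ B ∪ U}
  have key : ∀ v : V, ∃ g : Gate m V, (∀ u, g.Uses u → lev u.1 < lev v.1) ∧
      v.1 = match g with
        | .var i => X i
        | .const c => (c : MvPolynomial (Fin m) ℚ)
        | .add u w => u.1 + w.1
        | .mul u w => u.1 * w.1 := by
    rintro ⟨x, hx⟩
    by_cases hxB : x ∈ B
    · obtain ⟨i, rfl⟩ | ⟨c, rfl⟩ := hB x hxB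
      · exact ⟨.var i, by simp [Gate.Uses], rfl⟩
      · exact ⟨.const c, by simp [Gate.Uses], rfl⟩
    · have hxU : x ∈ U := (Finset.mem_union.1 hx).resolve_left hxB
      obtain ⟨⟨ha, hla⟩, ⟨hb, hlb⟩⟩ | ⟨⟨ha, hla⟩, ⟨hb, hlb⟩⟩ := hlev x hxU (by simpa using hxB)
      · refine ⟨.add ⟨_, Finset.mem_union.2 (by simpa using ha)⟩
          ⟨_, Finset.mem_union.2 (by simpa using hb)⟩, ?_, rfl⟩
        rintro u (rfl | rfl) <;> assumption
      · refine ⟨.mul ⟨_, Finset.mem_union.2 (by simpa using ha)⟩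
          ⟨_, Finset.mem_union.2 (by simpa using hb)⟩, ?_, rfl⟩
        rintro u (rfl | rfl) <;> assumption
  choose gate huses hval using key
  have acyclic : WellFounded fun u v : V => (gate v).Uses u :=
    Subrelation.wf (fun {u v} h => huses v u h) (InvImage.wf (fun v : V => lev v.1) wellFounded_lt)
  refine ⟨V, inferInstance, gate, acyclic, Subtype.val, ?_, ?_, ?_⟩
  · rw [Fintype.card_coe]
    exact Finset.card_union_le _ _
  · intro x hx
    exact ⟨⟨x, Finset.mem_union.2 hx⟩, rfl⟩
  · rintro out C rfl
    constructor
    · refine Finset.sup_le fun v _ => ?_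
      have hdep : ∀ v : V, Circuit.depthAt ⟨V, inferInstance, gate, acyclic, out⟩ v ≤ lev v.1 := by
        intro v
        induction v using acyclic.induction with
        | _ v ih =>
          rw [Circuit.depthAt_eq]
          have hu := huses v
          dsimp only
          generalize gate v = g at ih hu
          cases g with
          | var i => simp
          | const c => simp
          | add u w =>
            exact Nat.succ_le_of_lt (max_lt ((ih u (Or.inl rfl)).trans_lt (hu u (Or.inl rfl)))
              ((ih w (Or.inr rfl)).trans_lt (hu w (Or.inr rfl))))
          | mul u w =>
            exact Nat.succ_le_of_lt (max_lt ((ih u (Or.inl rfl)).trans_lt (hu u (Or.inl rfl)))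
              ((ih w (Or.inr rfl)).trans_lt (hu w (Or.inr rfl))))
      refine (hdep v).trans ?_
      obtain ⟨x, hx⟩ := v
      rcases Finset.mem_union.1 hx with hx | hx
      · simp [h0 x (by simpa using hx)]
      · exact hle x hx
    · intro l
      have hsem : ∀ v : V, Circuit.sem ⟨V, inferInstance, gate, acyclic, out⟩ v = v.1 := by
        intro v
        induction v using acyclic.induction with
        | _ v ih =>
          rw [Circuit.sem_eq, hval v]
          dsimp only
          generalize gate v = g at ih
          cases g with
          | var i => rfl
          | const c => rfl
          | add u w => exact congrArg₂ (· + ·) (ih u (Or.inl rfl)) (ih w (Or.inr rfl))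
          | mul u w => exact congrArg₂ (· * ·) (ih u (Or.inl rfl)) (ih w (Or.inr rfl))
      exact hsem _

/-- A set of rational functions that can be produced in `d` rounds is computed, in the form of
numerators and denominators, by a circuit of depth `2 * d`. -/
theorem Circuit.exists_of_der {m k : ℕ} {ι : Type*} (B : Finset (MvPolynomial (Fin m) ℚ))
    (hB : ∀ x ∈ B, (∃ i, x = X i) ∨ ∃ c : SignType, x = (c : MvPolynomial (Fin m) ℚ))
    (h0 : 0 ∈ B) (h1 : 1 ∈ B) {d c : ℕ} {T : Set (RatFun m)}
    (hT : Der FieldStep (polyToRat '' (B : Set (MvPolynomial (Fin m) ℚ))) T d c)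
    (f : ι → Fin k → RatFun m) (hf : ∀ i l, f i l ∈ T) :
    ∃ N D : ι → Circuit m k, ∀ i,
      (N i).size ≤ B.card + 4 * c ∧ (D i).size ≤ B.card + 4 * c ∧
      (N i).depth ≤ 2 * d ∧ (D i).depth ≤ 2 * d ∧
      ∀ l, (D i).outputs l ≠ 0 ∧
        polyToRat ((N i).outputs l) / polyToRat ((D i).outputs l) = f i l := by
  obtain ⟨U, hU, hcard, hsub⟩ := hT
  obtain ⟨T', hBT, ⟨U', hU', hcard', hT'⟩, hfrac⟩ := hU.exists_fractions (R := MvPolynomial (Fin m) ℚ)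
    (by simpa using h0) (by simpa using h1) subset_rfl
  obtain ⟨V, iV, gate, acyclic, val, hVcard, hex, hC⟩ :=
    Circuit.exists_of_chain (k := k) B hB hU'
  have hTv : ∀ x ∈ T', ∃ v, val v = x := fun x hx => hex x (by simpa using hT' hx)
  have key : ∀ i l, ∃ u v : V, val v ≠ 0 ∧ polyToRat (val u) / polyToRat (val v) = f i l := by
    intro i l
    obtain ⟨a, ha, b, hb, hb0, hab⟩ := hfrac (f i l) (by simpa using hsub (hf i l))
    obtain ⟨u, rfl⟩ := hTv a ha
    obtain ⟨v, rfl⟩ := hTv b hb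
    exact ⟨u, v, hb0, hab.symm⟩
  choose u v hv huv using key
  have hsize : Fintype.card V ≤ B.card + 4 * c := by omega
  refine ⟨fun i => ⟨V, iV, gate, acyclic, u i⟩, fun i => ⟨V, iV, gate, acyclic, v i⟩,
    fun i => ⟨hsize, hsize, (hC _ _ rfl).1, (hC _ _ rfl).1, fun l => ?_⟩⟩
  rw [(hC _ _ rfl).2, (hC _ _ rfl).2]
  exact ⟨hv i l, huv i l⟩

/-! ### Balanced sums, products and matrix powers -/

section Lists

variable {α : Type*} {St : Set α → α → Prop} {S : Set α}

@[to_additive]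
theorem Der.list_prod_of_length_le [Monoid α] (hSt : MonoStep St)
    (hmul : ∀ (A : Set α) (a b : α), a ∈ A → b ∈ A → St A (a * b)) (h1 : 1 ∈ S) (r : ℕ)
    (l : List α) (hr : l.length ≤ 2 ^ r) (hl : ∀ x ∈ l, x ∈ S) :
    Der St S {l.prod} r (l.length - 1) := by
  induction r generalizing l with
  | zero =>
    match l with
    | [] => exact Der.of_subset (by simpa using h1)
    | [x] => exact Der.of_subset (by simpa using hl)
    | _ :: _ :: _ => simp at hr
  | succ r ih =>
    by_cases hlen : l.length ≤ 1
    · match l with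
      | [] => exact (Der.of_subset (by simpa using h1)).mono (Nat.zero_le _) le_rfl
      | [x] => exact (Der.of_subset (by simpa using hl)).mono (Nat.zero_le _) le_rfl
      | _ :: _ :: _ => simp at hlen
    · have hp : (l.take (l.length / 2)).prod * (l.drop (l.length / 2)).prod = l.prod :=
        List.prod_take_mul_prod_drop l _
      rw [← hp]
      have ha := ih (l.take (l.length / 2)) (by rw [List.length_take, pow_succ] at *; omega)
        fun x hx => hl x (List.mem_of_mem_take hx)
      have hb := ih (l.drop (l.length / 2)) (by rw [List.length_drop, pow_succ] at *; omega)
        fun x hx => hl x (List.mem_of_mem_drop hx)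
      refine ((ha.union hSt hb).trans_right hSt (Der.step _ (hmul _ _ _ ?_ ?_))).mono le_rfl ?_
      · simp
      · simp
      · simp only [List.length_take, List.length_drop]
        omega

end Lists

section Field

variable {K : Type*} [Field K] {S : Set K}

theorem Der.list_sum (h0 : 0 ∈ S) (l : List K) (hl : ∀ x ∈ l, x ∈ S) :
    Der FieldStep S {l.sum} (Nat.clog 2 l.length) l.length :=
  (Der.list_sum_of_length_le monoStep_fieldStep (fun _ _ _ ha hb => .add ha hb) h0 _ l
    (Nat.le_pow_clog one_lt_two _) hl).mono le_rfl (Nat.sub_le _ _)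

theorem Der.list_prod (h1 : 1 ∈ S) (l : List K) (hl : ∀ x ∈ l, x ∈ S) :
    Der FieldStep S {l.prod} (Nat.clog 2 l.length) l.length :=
  (Der.list_prod_of_length_le monoStep_fieldStep (fun _ _ _ ha hb => .mul ha hb) h1 _ l
    (Nat.le_pow_clog one_lt_two _) hl).mono le_rfl (Nat.sub_le _ _)

theorem Der.sum (h0 : 0 ∈ S) {ι : Type*} (I : Finset ι) (f : ι → K) (hf : ∀ i ∈ I, f i ∈ S) :
    Der FieldStep S {∑ i ∈ I, f i} (Nat.clog 2 I.card) I.card := by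
  have := Der.list_sum h0 (I.toList.map f) (by simpa using hf)
  simpa using this

theorem Der.natCast (h0 : 0 ∈ S) (h1 : 1 ∈ S) (k : ℕ) :
    Der FieldStep S {(k : K)} (Nat.clog 2 k) k := by
  have := Der.sum h0 (Finset.range k) (fun _ => (1 : K)) fun _ _ => h1
  simpa using this

theorem Der.pow (h1 : 1 ∈ S) {x : K} (hx : x ∈ S) (k : ℕ) :
    Der FieldStep S {x ^ k} (Nat.clog 2 k) k := by
  have := Der.list_prod h1 (List.replicate k x) (by simp +contextual [hx])
  simpa using this

theorem Der.sum_mul (h0 : 0 ∈ S) {ι : Type*} (I : Finset ι) (a b : ι → K)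
    (ha : ∀ i ∈ I, a i ∈ S) (hb : ∀ i ∈ I, b i ∈ S) :
    Der FieldStep S {∑ i ∈ I, a i * b i} (1 + Nat.clog 2 I.card) (2 * I.card) := by
  have h : Der FieldStep S (⋃ i ∈ I, {a i * b i}) 1 (I.card * 1) :=
    Der.biUnion monoStep_fieldStep I fun i hi => Der.step _ (.mul (ha i hi) (hb i hi))
  refine (h.trans_right monoStep_fieldStep (Der.sum (Set.mem_union_left _ h0) I (fun i => a i * b i)
    fun i hi => Set.mem_union_right _ ?_)).mono le_rfl (by omega)
  simp only [Set.mem_iUnion]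
  exact ⟨i, hi, rfl⟩

variable {ι : Type*} [Fintype ι]

/-- The set of entries of a matrix. -/
def matrixEntries {ι κ K : Type*} (A : Matrix ι κ K) : Set K := Set.range fun p : ι × κ => A p.1 p.2

theorem matrixEntries_subset {ι K : Type*} {S : Set K} {A : Matrix ι ι K} : matrixEntries A ⊆ S ↔ ∀ i j, A i j ∈ S := by
  simp [matrixEntries, Set.range_subset_iff]

theorem Der.entries_of_forall {A : Matrix ι ι K} {d c : ℕ}
    (h : ∀ i j, Der FieldStep S {A i j} d c) :
    Der FieldStep S (matrixEntries A) d (Fintype.card ι * Fintype.card ι * c) := by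
  rw [← Fintype.card_prod]
  exact Der.range monoStep_fieldStep fun p => h p.1 p.2

theorem Der.matrix_mul (h0 : 0 ∈ S) {A B : Matrix ι ι K} (hA : matrixEntries A ⊆ S)
    (hB : matrixEntries B ⊆ S) :
    Der FieldStep S (matrixEntries (A * B)) (1 + Nat.clog 2 (Fintype.card ι))
      (2 * Fintype.card ι ^ 3) := by
  rw [matrixEntries_subset] at hA hB
  refine (Der.entries_of_forall fun i j => ?_).mono le_rfl
    (c := Fintype.card ι * Fintype.card ι * (2 * Fintype.card ι)) (by ring_nf; rfl)
  rw [Matrix.mul_apply]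
  exact Der.sum_mul h0 Finset.univ _ _ (fun k _ => hA _ _) fun k _ => hB _ _

theorem Der.mulVec (h0 : 0 ∈ S) {A : Matrix ι ι K} {v : ι → K} (hA : ∀ i j, A i j ∈ S)
    (hv : ∀ i, v i ∈ S) :
    Der FieldStep S (Set.range (A.mulVec v)) (1 + Nat.clog 2 (Fintype.card ι))
      (Fintype.card ι * (2 * Fintype.card ι)) :=
  Der.range monoStep_fieldStep fun i =>
    Der.sum_mul h0 Finset.univ _ _ (fun k _ => hA i k) fun k _ => hv k

theorem Der.matrix_pow_le [DecidableEq ι] (h0 : 0 ∈ S) (h1 : 1 ∈ S) {A : Matrix ι ι K}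
    (hA : matrixEntries A ⊆ S) (r : ℕ) :
    Der FieldStep S (⋃ k ∈ Finset.range (2 ^ r + 1), matrixEntries (A ^ k))
      (r * (1 + Nat.clog 2 (Fintype.card ι))) (8 * 2 ^ r * Fintype.card ι ^ 3) := by
  induction r with
  | zero =>
    refine (Der.of_subset ?_).mono (Nat.zero_le _) (Nat.zero_le _)
    simp only [pow_zero, Set.iUnion_subset_iff, Finset.mem_range]
    intro k hk
    interval_cases k
    · rw [matrixEntries_subset]
      intro i j
      rw [pow_zero, Matrix.one_apply]
      split_ifs <;> assumption
    · simpa using hA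
  | succ r ih =>
    rw [add_mul, one_mul]
    refine (ih.trans_right monoStep_fieldStep (Der.biUnion monoStep_fieldStep
      (Finset.range (2 ^ (r + 1) + 1)) (F := fun k => matrixEntries (A ^ k))
      (c := 2 * Fintype.card ι ^ 3) (d := 1 + Nat.clog 2 (Fintype.card ι))
      fun k hk => ?_)).mono le_rfl ?_
    · rw [Finset.mem_range, pow_succ] at hk
      have hsub : ∀ l, l < 2 ^ r + 1 → matrixEntries (A ^ l) ⊆
          S ∪ ⋃ k ∈ Finset.range (2 ^ r + 1), matrixEntries (A ^ k) := fun l hl =>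
        Set.subset_union_of_subset_right
          (Set.subset_biUnion_of_mem (u := fun k => matrixEntries (A ^ k))
            (Finset.mem_coe.2 (Finset.mem_range.2 hl))) _
      rw [show A ^ k = A ^ (k / 2) * A ^ (k - k / 2) by rw [← pow_add]; congr 1; omega]
      exact Der.matrix_mul (Set.mem_union_left _ h0) (hsub _ (by omega)) (hsub _ (by omega))
    · rw [Finset.card_range, pow_succ 2 r]
      have h2 : 1 ≤ 2 ^ r := Nat.one_le_two_pow
      have h3 := Nat.mul_le_mul_right (Fintype.card ι ^ 3) h2
      rw [show 8 * (2 ^ r * 2) * Fintype.card ι ^ 3 = 16 * (2 ^ r * Fintype.card ι ^ 3) by ring,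
        show 8 * 2 ^ r * Fintype.card ι ^ 3 = 8 * (2 ^ r * Fintype.card ι ^ 3) by ring,
        show (2 ^ r * 2 + 1) * (2 * Fintype.card ι ^ 3)
          = 4 * (2 ^ r * Fintype.card ι ^ 3) + 2 * Fintype.card ι ^ 3 by ring]
      omega

theorem two_pow_clog_le (n : ℕ) : 2 ^ Nat.clog 2 (n + 1) ≤ 2 * (n + 1) := by
  rcases Nat.eq_zero_or_pos n with rfl | hn
  · simp
  · have h := Nat.pow_pred_clog_lt_self one_lt_two (show 1 < n + 1 by omega)
    have hpos := Nat.clog_pos one_lt_two (show 2 ≤ n + 1 by omega)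
    obtain ⟨c, hc⟩ := Nat.exists_eq_succ_of_ne_zero hpos.ne'
    rw [hc, Nat.pred_succ] at h
    rw [hc, Nat.succ_eq_add_one, pow_succ]
    omega

end Field

/-! ### Newton's identities for the characteristic polynomial -/

namespace Matrix

/-- Jacobi's formula for `det (1 - t A)`. -/
theorem eval_derivative_charpolyRev {R ι : Type*} [CommRing R] [Fintype ι] [DecidableEq ι]
    (A G : Matrix ι ι R) (t : R) (hG : (1 - t • A) * G = 1) :
    (Polynomial.derivative A.charpolyRev).eval t = -(det (1 - t • A) * trace (G * A)) := by
  have hcomp : A.charpolyRev.comp (Polynomial.X + Polynomial.C t)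
      = Polynomial.C (det (1 - t • A)) * det (1 + (Polynomial.X : Polynomial R) • (-(G * A)).map Polynomial.C) := by
    have h1 : Polynomial.C (det (1 - t • A)) = det ((1 - t • A).map Polynomial.C) := by
      rw [← RingHom.mapMatrix_apply, ← RingHom.map_det]
    have hG' : (1 - t • A).map Polynomial.C * G.map Polynomial.C = (1 : Matrix ι ι (Polynomial R)) := by
      rw [← Matrix.map_mul, hG, Matrix.map_one _ (map_zero Polynomial.C) (map_one Polynomial.C)]
    have h2 : A.charpolyRev.comp (Polynomial.X + Polynomial.C t)
        = det ((1 : Matrix ι ι (Polynomial R)) - (Polynomial.X + Polynomial.C t) • A.map Polynomial.C) := by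
      have := RingHom.map_det (Polynomial.compRingHom (Polynomial.X + Polynomial.C t)) (1 - (Polynomial.X : Polynomial R) • A.map Polynomial.C)
      rw [charpolyRev, ← Polynomial.coe_compRingHom_apply, this]
      congr 1
      ext i j : 1
      by_cases hij : i = j <;> simp [hij] <;> exact mul_comm _ _
    rw [h1, h2, ← det_mul]
    congr 1
    have h3 : (1 - t • A).map Polynomial.C = (1 : Matrix ι ι (Polynomial R)) - Polynomial.C t • A.map Polynomial.C := by
      ext i j : 1
      simp [Matrix.one_apply, apply_ite Polynomial.C]
    have h4 : (-(G * A)).map Polynomial.C = -(G.map Polynomial.C * A.map Polynomial.C) := by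
      rw [← Matrix.map_mul]
      ext i j : 1
      simp only [Matrix.map_apply, Matrix.neg_apply, Polynomial.C_neg]
    rw [h4, mul_add, mul_one, Matrix.mul_smul, mul_neg, ← Matrix.mul_assoc, hG', h3, one_mul,
      add_smul, smul_neg]
    abel
  have h := congrArg (fun p => (Polynomial.derivative p).eval 0) hcomp
  simp only [Polynomial.derivative_comp, Polynomial.derivative_C_mul, Polynomial.eval_mul,
    Polynomial.eval_C, derivative_det_one_add_X_smul, Polynomial.eval_comp,
    Polynomial.derivative_add, Polynomial.derivative_X, Polynomial.derivative_C,
    Polynomial.eval_add, Polynomial.eval_X, zero_add, add_zero, one_mul,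
    trace_neg] at h
  rw [h, mul_neg]

theorem map_charpolyRev {R S ι : Type*} [CommRing R] [CommRing S] [Fintype ι] [DecidableEq ι]
    (f : R →+* S) (A : Matrix ι ι R) : (A.map f).charpolyRev = A.charpolyRev.map f := by
  rw [charpolyRev, charpolyRev, ← Polynomial.coe_mapRingHom, RingHom.map_det]
  congr 1
  ext i j : 1
  simp [Matrix.one_apply, apply_ite (Polynomial.map f)]

/-- Newton's identities for the reversed characteristic polynomial. -/
theorem coeff_charpolyRev_succ {R ι : Type*} [CommRing R] [Fintype ι] [DecidableEq ι]
    (A : Matrix ι ι R) (k : ℕ) :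
    ((k : R) + 1) * A.charpolyRev.coeff (k + 1)
      = -∑ p ∈ Finset.HasAntidiagonal.antidiagonal k, A.charpolyRev.coeff p.1 * trace (A ^ (p.2 + 1)) := by
  let G : Matrix ι ι (PowerSeries R) := Matrix.of fun i j => PowerSeries.mk fun k => (A ^ k) i j
  let B : Matrix ι ι (PowerSeries R) := A.map (PowerSeries.C)
  have hBG : ∀ i j k, PowerSeries.coeff k ((B * G) i j) = (A ^ (k + 1)) i j := by
    intro i j k
    simp [B, G, Matrix.mul_apply, pow_succ']
  have hGB : ∀ i j k, PowerSeries.coeff k ((G * B) i j) = (A ^ (k + 1)) i j := by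
    intro i j k
    simp [B, G, Matrix.mul_apply, pow_succ]
  have hG : (1 - (PowerSeries.X : PowerSeries R) • B) * G = 1 := by
    rw [sub_mul, one_mul, Matrix.smul_mul]
    ext i j k
    rw [sub_apply, smul_apply, smul_eq_mul, map_sub]
    cases k with
    | zero =>
      by_cases hij : i = j <;> simp [G, Matrix.one_apply, hij]
    | succ k =>
      rw [PowerSeries.coeff_succ_X_mul, hBG]
      by_cases hij : i = j <;> simp [G, Matrix.one_apply, hij, PowerSeries.coeff_one]
  have h := eval_derivative_charpolyRev B G PowerSeries.X hG
  have hev : ∀ p : Polynomial R, (p.map (PowerSeries.C)).eval PowerSeries.X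
      = (p : PowerSeries R) := fun p => by
    rw [Polynomial.eval_map, Polynomial.eval₂_C_X_eq_coe]
  have hdet : det (1 - (PowerSeries.X : PowerSeries R) • B)
      = (A.charpolyRev : PowerSeries R) := by
    rw [← hev, ← map_charpolyRev, charpolyRev, ← Polynomial.coe_evalRingHom, RingHom.map_det]
    congr 1
    ext i j : 1
    by_cases hij : i = j <;> simp [B, hij] <;> exact mul_comm _ _
  rw [map_charpolyRev, Polynomial.derivative_map, hev, hdet] at h
  have hk := congrArg (PowerSeries.coeff k) h
  rw [Polynomial.coeff_coe, Polynomial.coeff_derivative, map_neg, PowerSeries.coeff_mul] at hk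
  rw [mul_comm, hk]
  congr 1
  refine Finset.sum_congr rfl fun p _ => ?_
  rw [Polynomial.coeff_coe, trace, trace, map_sum]
  simp [hGB]

variable {K : Type*} [Field K] [CharZero K] {n : ℕ}

/-- The strictly lower triangular matrix of the recursion that Newton's identities give for the
coefficients of `det (1 - t A)`. -/
noncomputable def newtonMatrix (A : Matrix (Fin n) (Fin n) K) :
    Matrix (Fin (n + 1)) (Fin (n + 1)) K :=
  Matrix.of fun k i => if i < k then -1 * (k.val : K)⁻¹ * trace (A ^ (k.val - i.val)) else 0

omit [CharZero K] in
theorem newtonMatrix_pow_apply_eq_zero (A : Matrix (Fin n) (Fin n) K) (j : ℕ) (k i : Fin (n + 1))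
    (h : k.val < i.val + j) : (newtonMatrix A ^ j) k i = 0 := by
  induction j generalizing k with
  | zero =>
    have : k ≠ i := fun hki => by simp [hki] at h
    simp [this]
  | succ j ih =>
    rw [pow_succ', mul_apply]
    refine Finset.sum_eq_zero fun l _ => ?_
    by_cases hl : l < k
    · rw [ih l (by have := Fin.lt_def.1 hl; omega), mul_zero]
    · simp [newtonMatrix, hl]

theorem newtonMatrix_mulVec (A : Matrix (Fin n) (Fin n) K) :
    (1 - newtonMatrix A) *ᵥ (fun i : Fin (n + 1) => A.charpolyRev.coeff i) = Pi.single 0 1 := by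
  rw [sub_mulVec, one_mulVec, sub_eq_iff_eq_add]
  ext k
  rw [Pi.add_apply]
  have hmv : (newtonMatrix A *ᵥ fun i : Fin (n + 1) => A.charpolyRev.coeff i) k
      = ∑ i ∈ Finset.range k.val,
        -1 * (k.val : K)⁻¹ * trace (A ^ (k.val - i)) * A.charpolyRev.coeff i := by
    simp only [mulVec, dotProduct, newtonMatrix, of_apply, Fin.lt_def, ite_mul, zero_mul]
    rw [Fin.sum_univ_eq_sum_range (fun i => if i < k.val then
      -1 * (k.val : K)⁻¹ * trace (A ^ (k.val - i)) * A.charpolyRev.coeff i else 0) (n + 1),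
      ← Finset.sum_filter]
    congr 1
    ext i
    simp only [Finset.mem_filter, Finset.mem_range]
    omega
  rw [hmv]
  obtain ⟨k, hk⟩ := k
  cases k with
  | zero =>
    have := A.eval_charpolyRev
    rw [← Polynomial.coeff_zero_eq_eval_zero] at this
    simp [this]
  | succ k =>
    have hne : (k : K) + 1 ≠ 0 := by exact_mod_cast Nat.succ_ne_zero k
    have h0 : (⟨k + 1, hk⟩ : Fin (n + 1)) ≠ 0 := by simp [Fin.ext_iff]
    rw [Pi.single_eq_of_ne h0, zero_add]
    refine mul_left_cancel₀ hne ?_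
    dsimp only
    rw [coeff_charpolyRev_succ, Finset.Nat.sum_antidiagonal_eq_sum_range_succ
      (fun i j => A.charpolyRev.coeff i * trace (A ^ (j + 1))), Finset.mul_sum,
      ← Finset.sum_neg_distrib]
    refine Finset.sum_congr rfl fun i hi => ?_
    have : k - i + 1 = k + 1 - i := by have := Finset.mem_range.1 hi; omega
    rw [this]
    push_cast
    field_simp

theorem coeff_charpolyRev_eq_sum (A : Matrix (Fin n) (Fin n) K) (i : Fin (n + 1)) :
    A.charpolyRev.coeff i = ∑ j ∈ Finset.range (n + 1), (newtonMatrix A ^ j) i 0 := by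
  have hnil : newtonMatrix A ^ (n + 1) = 0 := by
    ext k l
    exact newtonMatrix_pow_apply_eq_zero A _ _ _ (by omega)
  have h := congrArg (fun v => (∑ j ∈ Finset.range (n + 1), newtonMatrix A ^ j) *ᵥ v)
    (newtonMatrix_mulVec A)
  simp only [mulVec_mulVec, geom_sum_mul_neg, hnil, sub_zero, one_mulVec, mulVec_single_one] at h
  have := congrFun h i
  simpa [Matrix.sum_apply] using this

omit [CharZero K] in
theorem sum_coeff_charpolyRev (A : Matrix (Fin n) (Fin n) K) :
    ∑ i ∈ Finset.range (n + 1), A.charpolyRev.coeff i = det (1 - A) := by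
  have hdeg : A.charpolyRev.natDegree < n + 1 := by
    rw [← reverse_charpoly]
    refine Nat.lt_succ_of_le ((Polynomial.reverse_natDegree_le _).trans ?_)
    simp
  have h := Polynomial.eval_eq_sum_range' hdeg (1 : K)
  simp only [one_pow, mul_one] at h
  rw [← h, charpolyRev, ← Polynomial.coe_evalRingHom, RingHom.map_det]
  congr 1
  ext i j : 1
  simp [Matrix.one_apply, apply_ite (Polynomial.eval (1 : K))]

omit [CharZero K] in
theorem one_sub_mul_sum_charpolyRev (A : Matrix (Fin n) (Fin n) K) :
    (1 - A) * ∑ i ∈ Finset.range (n + 1),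
      A.charpolyRev.coeff i • ∑ j ∈ Finset.range (n + 1 - i), A ^ j = det (1 - A) • 1 := by
  have hCH : ∑ i ∈ Finset.range (n + 1), A.charpolyRev.coeff i • A ^ (n - i) = 0 := by
    rw [← aeval_self_charpoly A, Polynomial.aeval_eq_sum_range' (n := n + 1) (by simp),
      ← Finset.sum_range_reflect]
    refine Finset.sum_congr rfl fun i hi => ?_
    have hi := Finset.mem_range.1 hi
    have h2 : n - (n + 1 - 1 - i) = i := by omega
    rw [← reverse_charpoly, Polynomial.coeff_reverse, h2, charpoly_natDegree_eq_dim,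
      Fintype.card_fin, Polynomial.revAt_le (by omega), h2]
  rw [Finset.mul_sum, ← sum_coeff_charpolyRev, Finset.sum_smul]
  rw [← sub_eq_zero, ← Finset.sum_sub_distrib, ← neg_eq_zero, ← Finset.sum_neg_distrib,
    ← mul_zero A, ← hCH, Finset.mul_sum]
  refine Finset.sum_congr rfl fun i hi => ?_
  have hi := Finset.mem_range.1 hi
  rw [Matrix.mul_smul, mul_neg_geom_sum, smul_sub, Matrix.mul_smul, ← pow_succ',
    show n + 1 - i = n - i + 1 by omega]
  abel

end Matrix

/-! ### Matrix inversion in polylogarithmic depth -/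

section Inverse

variable {K : Type*} [Field K] [CharZero K] {S : Set K} {n : ℕ}

omit [CharZero K] in
theorem Der.matrix_pow_lt {ι : Type*} [Fintype ι] [DecidableEq ι] {s : ℕ} (h0 : 0 ∈ S)
    (h1 : 1 ∈ S) {A : Matrix ι ι K} (hA : matrixEntries A ⊆ S) (hs : 1 ≤ s)
    (hι : Fintype.card ι ≤ s) :
    Der FieldStep S (⋃ k ∈ Finset.range s, matrixEntries (A ^ k))
      (Nat.clog 2 s * (1 + Nat.clog 2 s)) (16 * s ^ 4) := by
  have hlog : Nat.clog 2 (Fintype.card ι) ≤ Nat.clog 2 s := Nat.clog_mono_right 2 hι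
  refine ((Der.matrix_pow_le h0 h1 hA (Nat.clog 2 s)).subset ?_).mono (by gcongr) ?_
  · refine Set.biUnion_subset_biUnion_left fun k hk => ?_
    have hle := Nat.le_pow_clog one_lt_two s
    simp only [Finset.coe_range, Set.mem_Iio] at hk ⊢
    omega
  · obtain ⟨t, rfl⟩ := Nat.exists_eq_add_of_le' hs
    calc 8 * 2 ^ Nat.clog 2 (t + 1) * Fintype.card ι ^ 3
        ≤ 8 * (2 * (t + 1)) * (t + 1) ^ 3 := by gcongr; exact two_pow_clog_le t
      _ = 16 * (t + 1) ^ 4 := by ring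

/-- Csanky's algorithm. -/
theorem Der.matrix_inv (h0 : 0 ∈ S) (h1 : 1 ∈ S) (hneg : -1 ∈ S) {A : Matrix (Fin n) (Fin n) K}
    (hA : matrixEntries A ⊆ S) (hdet : Matrix.det (1 - A) ≠ 0) :
    Der FieldStep S (matrixEntries (1 - A)⁻¹) (20 * (1 + Nat.clog 2 (n + 1)) ^ 2)
      (100 * (n + 1) ^ 5) := by
  set L := Nat.clog 2 (n + 1) with hL
  have hmono := monoStep_fieldStep (K := K)
  have hlog : ∀ k, k ≤ n + 1 → Nat.clog 2 k ≤ L := fun k hk => Nat.clog_mono_right 2 hk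
  let N := Matrix.newtonMatrix A
  let q : ℕ → K := A.charpolyRev.coeff
  let R := Finset.range (n + 1)
  have hcardR : R.card = n + 1 := Finset.card_range _
  have hRlt : ∀ {k}, k ∈ R ↔ k < n + 1 := Finset.mem_range
  let T1 : Set K := ⋃ k ∈ R, matrixEntries (A ^ k)
  let T2 : Set K := ⋃ k ∈ R, {Matrix.trace (A ^ k), (k : K)}
  let T3 : Set K := matrixEntries N
  let T4 : Set K := ⋃ k ∈ R, matrixEntries (N ^ k)
  let T5 : Set K := ⋃ k ∈ R, {q k}
  let B : ℕ → Matrix (Fin n) (Fin n) K := fun i => ∑ j ∈ Finset.range (n + 1 - i), A ^ j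
  let T6 : Set K := {Matrix.det (1 - A)} ∪ ⋃ i ∈ R, matrixEntries (B i)
  have d1 : Der FieldStep S T1 (L * (1 + L)) (16 * (n + 1) ^ 4) :=
    Der.matrix_pow_lt h0 h1 hA (by omega) (by simp)
  have d2 : Der FieldStep (S ∪ T1) T2 L ((n + 1) * (n + (n + 1))) := by
    rw [← hcardR]
    refine Der.biUnion hmono R fun k hk => ?_
    rw [hRlt] at hk
    refine Der.union hmono ((Der.sum (Set.mem_union_left _ h0) Finset.univ _
      fun i _ => Set.mem_union_right _ ?_).mono ?_ ?_)
      ((Der.natCast (Set.mem_union_left _ h0) (Set.mem_union_left _ h1) k).mono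
        (hlog _ (by omega)) (by omega))
    · exact Set.mem_biUnion (Finset.mem_coe.2 (hRlt.2 hk)) ⟨(i, i), rfl⟩
    · exact hlog _ (by simp)
    · simp
  have d3 : Der FieldStep (S ∪ T1 ∪ T2) T3 3 ((n + 1) * (n + 1) * 3) := by
    have hS : S ⊆ S ∪ T1 ∪ T2 := Set.subset_union_left.trans Set.subset_union_left
    refine (Der.entries_of_forall (ι := Fin (n + 1)) (d := 3) (c := 3) fun k i => ?_).mono le_rfl
      (by simp)
    by_cases hik : i < k
    · have hk : ∀ j < n + 1, Matrix.trace (A ^ j) ∈ T2 ∧ (j : K) ∈ T2 := fun j hj =>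
        ⟨Set.mem_biUnion (Finset.mem_coe.2 (hRlt.2 hj)) (by simp),
          Set.mem_biUnion (Finset.mem_coe.2 (hRlt.2 hj)) (by simp)⟩
      have hN : N k i = -1 * (k.val : K)⁻¹ * Matrix.trace (A ^ (k.val - i.val)) := by
        simp [N, Matrix.newtonMatrix, hik]
      rw [hN]
      have e1 : Der FieldStep (S ∪ T1 ∪ T2) {(k.val : K)⁻¹} 1 1 :=
        Der.step _ (.inv (Or.inr (hk k k.2).2))
      have e2 : Der FieldStep (S ∪ T1 ∪ T2 ∪ {(k.val : K)⁻¹}) {-1 * (k.val : K)⁻¹} 1 1 :=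
        Der.step _ (.mul (Or.inl (hS hneg)) (Or.inr rfl))
      have e3 := Der.step (St := FieldStep)
        (S := S ∪ T1 ∪ T2 ∪ {(k.val : K)⁻¹} ∪ {-1 * (k.val : K)⁻¹})
        (-1 * (k.val : K)⁻¹ * Matrix.trace (A ^ (k.val - i.val)))
        (.mul (Or.inr rfl) (Or.inl (Or.inl (Or.inr (hk _ (by omega)).1))))
      exact e1.trans_right hmono (e2.trans_right hmono e3)
    · have hN : N k i = 0 := by simp [N, Matrix.newtonMatrix, hik]
      rw [hN]
      exact (Der.of_subset (by simpa using hS h0)).mono (Nat.zero_le _) (Nat.zero_le _)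
  have d4 : Der FieldStep (S ∪ T1 ∪ T2 ∪ T3) T4 (L * (1 + L)) (16 * (n + 1) ^ 4) := by
    have hS : S ⊆ S ∪ T1 ∪ T2 ∪ T3 :=
      (Set.subset_union_left.trans Set.subset_union_left).trans Set.subset_union_left
    exact Der.matrix_pow_lt (hS h0) (hS h1) Set.subset_union_right (by omega) (by simp)
  have d5 : Der FieldStep (S ∪ T1 ∪ T2 ∪ T3 ∪ T4) T5 L ((n + 1) * (n + 1)) := by
    have hS : S ⊆ S ∪ T1 ∪ T2 ∪ T3 ∪ T4 :=
      ((Set.subset_union_left.trans Set.subset_union_left).trans Set.subset_union_left).trans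
        Set.subset_union_left
    conv => enter [5, 1]; rw [← hcardR]
    refine Der.biUnion hmono R fun k hk => ?_
    rw [hRlt] at hk
    have hq : q k = ∑ j ∈ R, (N ^ j) ⟨k, hk⟩ 0 := Matrix.coeff_charpolyRev_eq_sum A ⟨k, hk⟩
    rw [hq]
    refine (Der.sum (hS h0) R _ fun j hj => Set.mem_union_right _ ?_).mono
      (hlog _ hcardR.le) hcardR.le
    exact Set.mem_biUnion (Finset.mem_coe.2 hj) ⟨(⟨k, hk⟩, 0), rfl⟩
  have d6 : Der FieldStep (S ∪ T1 ∪ T2 ∪ T3 ∪ T4 ∪ T5) T6 L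
      ((n + 1) + (n + 1) * (n * n * (n + 1))) := by
    have hS : S ∪ T1 ⊆ S ∪ T1 ∪ T2 ∪ T3 ∪ T4 ∪ T5 :=
      ((Set.subset_union_left.trans Set.subset_union_left).trans Set.subset_union_left).trans
        Set.subset_union_left
    refine Der.union hmono ?_ ?_
    · rw [← Matrix.sum_coeff_charpolyRev]
      refine (Der.sum (hS (Or.inl h0)) R _ fun k hk => Set.mem_union_right _ ?_).mono
        (hlog _ hcardR.le) hcardR.le
      exact Set.mem_biUnion (Finset.mem_coe.2 hk) rfl
    · conv => enter [5, 1]; rw [← hcardR]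
      refine Der.biUnion hmono R fun k hk => ?_
      refine (Der.entries_of_forall (d := L) (c := n + 1) fun i j => ?_).mono le_rfl (by simp)
      have hB : B k i j = ∑ l ∈ Finset.range (n + 1 - k), (A ^ l) i j := by
        simp [B, Matrix.sum_apply]
      rw [hB]
      refine (Der.sum (hS (Or.inl h0)) _ _ fun l hl => hS (Or.inr ?_)).mono (hlog _ ?_) ?_
      · have hl : l ∈ R := hRlt.2 (by have := Finset.mem_range.1 hl; omega)
        exact Set.mem_biUnion (Finset.mem_coe.2 hl) ⟨(i, j), rfl⟩
      · simp
      · simp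
  have d7 : Der FieldStep (S ∪ T1 ∪ T2 ∪ T3 ∪ T4 ∪ T5 ∪ T6) (matrixEntries (1 - A)⁻¹)
      (1 + L + 1 + 1) (n * n * (2 * (n + 1) + 1 + 1)) := by
    have hinv : (1 - A)⁻¹ = (Matrix.det (1 - A))⁻¹ • ∑ i ∈ R, q i • B i := by
      refine Matrix.inv_eq_right_inv ?_
      rw [Matrix.mul_smul, Matrix.one_sub_mul_sum_charpolyRev, smul_smul, inv_mul_cancel₀ hdet,
        one_smul]
    rw [hinv]
    refine (Der.entries_of_forall (d := 1 + L + 1 + 1) (c := 2 * (n + 1) + 1 + 1)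
      fun i j => ?_).mono le_rfl (by simp)
    rw [Matrix.smul_apply, Matrix.sum_apply, smul_eq_mul]
    simp only [Matrix.smul_apply, smul_eq_mul]
    have hS : S ⊆ S ∪ T1 ∪ T2 ∪ T3 ∪ T4 ∪ T5 ∪ T6 :=
      ((((Set.subset_union_left.trans Set.subset_union_left).trans Set.subset_union_left).trans
        Set.subset_union_left).trans Set.subset_union_left).trans Set.subset_union_left
    have e1 := (Der.sum_mul (hS h0) R q (fun k => B k i j)
      (fun k hk => Or.inl (Or.inr (Set.mem_biUnion (Finset.mem_coe.2 hk) rfl)))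
      (fun k hk => Or.inr (Or.inr (Set.mem_biUnion (Finset.mem_coe.2 hk) ⟨(i, j), rfl⟩)))).mono
        (Nat.add_le_add_left (hlog _ hcardR.le) 1) (Nat.mul_le_mul_left 2 hcardR.le)
    have e2 : Der FieldStep (S ∪ T1 ∪ T2 ∪ T3 ∪ T4 ∪ T5 ∪ T6 ∪ {∑ k ∈ R, q k * B k i j})
        {(Matrix.det (1 - A))⁻¹} 1 1 :=
      Der.step _ (.inv (Or.inl (Or.inr (Or.inl rfl))))
    have e3 : Der FieldStep (S ∪ T1 ∪ T2 ∪ T3 ∪ T4 ∪ T5 ∪ T6 ∪ {∑ k ∈ R, q k * B k i j} ∪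
        {(Matrix.det (1 - A))⁻¹})
        {(Matrix.det (1 - A))⁻¹ * ∑ k ∈ R, q k * B k i j} 1 1 :=
      Der.step _ (.mul (Or.inr rfl) (Or.inl (Or.inr rfl)))
    refine (e1.trans_right hmono (e2.trans_right hmono e3)).mono (by omega) (by omega)
  refine (d1.trans_right hmono (d2.trans_right hmono (d3.trans_right hmono
    (d4.trans_right hmono (d5.trans_right hmono (d6.trans_right hmono d7)))))).mono ?_ ?_
  · nlinarith
  · generalize hs : n + 1 = s
    have hn : n ≤ s := by omega
    have hs1 : 1 ≤ s := by omega
    have p1 : s ^ 1 ≤ s ^ 5 := Nat.pow_le_pow_right hs1 (by omega)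
    rw [pow_one] at p1
    have p2 : s ^ 2 ≤ s ^ 5 := Nat.pow_le_pow_right hs1 (by omega)
    have p3 : s ^ 3 ≤ s ^ 5 := Nat.pow_le_pow_right hs1 (by omega)
    have p4 : s ^ 4 ≤ s ^ 5 := Nat.pow_le_pow_right hs1 (by omega)
    have q2 : s * (n + s) ≤ 2 * s ^ 2 := by nlinarith
    have q3 : s * s * 3 = 3 * s ^ 2 := by ring
    have q5 : s * s = s ^ 2 := by ring
    have q6 : s * (n * n * s) ≤ s ^ 4 := by
      calc s * (n * n * s) ≤ s * (s * s * s) := by gcongr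
        _ = s ^ 4 := by ring
    have q7 : n * n * (2 * s + 1 + 1) ≤ 4 * s ^ 3 := by
      calc n * n * (2 * s + 1 + 1) ≤ s * s * (2 * s + s + s) := by gcongr
        _ = 4 * s ^ 3 := by ring
    omega

end Inverse

/-! ### Numbers and polynomials -/

section Numbers

variable {K : Type*} [Field K] {S : Set K}

theorem Der.natCast_of_lt_two_pow (h0 : 0 ∈ S) (h1 : 1 ∈ S) {a b : ℕ} (hab : a < 2 ^ b) :
    Der FieldStep S {(a : K)} (2 * Nat.clog 2 b + 1) (1 + b * b + b) := by
  have hmono := monoStep_fieldStep (K := K)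
  have e1 : Der FieldStep S {(2 : K)} 1 1 := by
    rw [← one_add_one_eq_two]
    exact Der.step _ (.add h1 h1)
  have hI : ∀ i ∈ a.bitIndices.toFinset, i < b := fun i hi => by
    have h := Nat.two_pow_le_of_mem_bitIndices (List.mem_toFinset.1 hi)
    exact (Nat.pow_lt_pow_iff_right one_lt_two).1 (h.trans_lt hab)
  have hcard : a.bitIndices.toFinset.card ≤ b := by
    have := Finset.card_le_card (t := Finset.range b) fun i hi => Finset.mem_range.2 (hI i hi)
    simpa using this
  have e2 : Der FieldStep (S ∪ {2}) (⋃ i ∈ a.bitIndices.toFinset, {(2 : K) ^ i}) (Nat.clog 2 b)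
      (a.bitIndices.toFinset.card * b) :=
    Der.biUnion hmono _ fun i hi => (Der.pow (Set.mem_union_left _ h1)
      (Set.mem_union_right _ (Set.mem_singleton (2 : K))) i).mono
      (Nat.clog_mono_right 2 (hI i hi).le) (hI i hi).le
  have hsum : (a : K) = ∑ i ∈ a.bitIndices.toFinset, (2 : K) ^ i := by
    conv_lhs => rw [← Finset.sum_toFinset_bitIndices_two_pow a]
    push_cast
    rfl
  rw [hsum]
  have e3 := Der.sum (S := S ∪ {2} ∪ ⋃ i ∈ a.bitIndices.toFinset, {(2 : K) ^ i})
    (Or.inl (Or.inl h0)) a.bitIndices.toFinset (fun i => (2 : K) ^ i)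
    fun i hi => Or.inr (Set.mem_biUnion (Finset.mem_coe.2 hi) rfl)
  have hclog := Nat.clog_mono_right 2 hcard
  have hmul := Nat.mul_le_mul_right b hcard
  exact (e1.trans_right hmono (e2.trans_right hmono e3)).mono (by omega) (by omega)

theorem Der.ratCast [CharZero K] (h0 : 0 ∈ S) (h1 : 1 ∈ S) (hneg : -1 ∈ S) {q : ℚ} {b : ℕ}
    (hnum : q.num.natAbs < 2 ^ b) (hden : q.den < 2 ^ b) :
    Der FieldStep S {(q : K)} (2 * Nat.clog 2 b + 4) (2 * (1 + b * b + b) + 3) := by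
  have hmono := monoStep_fieldStep (K := K)
  have e1 := (Der.natCast_of_lt_two_pow h0 h1 hnum).union hmono
    (Der.natCast_of_lt_two_pow h0 h1 hden)
  set T : Set K := {(q.num.natAbs : K)} ∪ {(q.den : K)} with hT
  have hsign : ((SignType.sign q.num : ℤ) : K) ∈ S := by
    rcases SignType.sign q.num with _ | _ | _ <;> simpa
  have e2 : Der FieldStep (S ∪ T) {(q.den : K)⁻¹} 1 1 := Der.step _ (.inv (Or.inr (Or.inr rfl)))
  have e3 : Der FieldStep (S ∪ T ∪ {(q.den : K)⁻¹})
      {((SignType.sign q.num : ℤ) : K) * (q.num.natAbs : K)} 1 1 :=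
    Der.step _ (.mul (Or.inl (Or.inl hsign)) (Or.inl (Or.inr (Or.inl rfl))))
  have hq : (q : K) = ((SignType.sign q.num : ℤ) : K) * (q.num.natAbs : K) * (q.den : K)⁻¹ := by
    have hn : ((SignType.sign q.num : ℤ) : K) * (q.num.natAbs : K) = (q.num : K) := by
      rw [← Int.cast_natCast q.num.natAbs, ← Int.cast_mul, Int.natCast_natAbs, sign_mul_abs]
    rw [hn, ← div_eq_mul_inv, Rat.cast_def]
  have e4 : Der FieldStep (S ∪ T ∪ {(q.den : K)⁻¹} ∪
      {((SignType.sign q.num : ℤ) : K) * (q.num.natAbs : K)}) {(q : K)} 1 1 := by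
    rw [hq]
    exact Der.step _ (.mul (Or.inr rfl) (Or.inl (Or.inr rfl)))
  exact (e1.trans_right hmono (e2.trans_right hmono (e3.trans_right hmono e4))).mono
    (by omega) (by omega)

end Numbers

section Polynomials

variable {m : ℕ} {S : Set (RatFun m)}

theorem polyToRat_ne_zero {p : MvPolynomial (Fin m) ℚ} (hp : p ≠ 0) :
    (polyToRat p : RatFun m) ≠ 0 := fun h =>
  hp (IsFractionRing.injective _ (RatFun m) (by simpa using h))

theorem polyToRat_monomial (α : Fin m →₀ ℕ) (c : ℚ) :
    polyToRat (monomial α c) = (c : RatFun m) *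
      ((Finsupp.toMultiset α).toList.map fun j => polyToRat (X j)).prod := by
  have hC : polyToRat (C c : MvPolynomial (Fin m) ℚ) = (c : RatFun m) :=
    eq_ratCast ((algebraMap (MvPolynomial (Fin m) ℚ) (RatFun m)).comp C) c
  have hX : (Finsupp.toMultiset α).toList.map (fun j => polyToRat (X j))
      = ((Finsupp.toMultiset α).toList.map X).map (algebraMap (MvPolynomial (Fin m) ℚ) (RatFun m)) := by
    rw [List.map_map]
    rfl
  rw [hX, ← map_list_prod, ← hC, ← map_mul]
  congr 1
  rw [monomial_eq, ← Multiset.prod_coe, ← Multiset.map_coe, Multiset.coe_toList,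
    Finsupp.toMultiset_map, Finsupp.prod_toMultiset, Finsupp.prod_mapDomain_index
      (fun _ => pow_zero _) fun _ _ _ => pow_add _ _ _]

/-- A polynomial whose coefficients have been multiplied by small natural numbers. -/
theorem Der.weighted_poly (h0 : 0 ∈ S) (h1 : 1 ∈ S) (hneg : -1 ∈ S)
    (p : MvPolynomial (Fin m) ℚ) (hX : ∀ j ∈ p.vars, polyToRat (X j) ∈ S) {s : ℕ}
    (hs : repSize p ≤ s) (w : (Fin m →₀ ℕ) → ℕ) (hw : ∀ α ∈ p.support, w α ≤ s) :
    Der FieldStep S {polyToRat (∑ α ∈ p.support, monomial α ((w α : ℚ) * p.coeff α))}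
      (5 * Nat.clog 2 s + 6) (20 * s ^ 3) := by
  have hmono := monoStep_fieldStep (K := RatFun m)
  by_cases hp : p.support = ∅
  · rw [hp]
    exact (Der.of_subset (by simpa using h0)).mono (Nat.zero_le _) (Nat.zero_le _)
  have hcardpos : 1 ≤ p.support.card := Finset.card_pos.2 (Finset.nonempty_iff_ne_empty.2 hp)
  have hdegpos : 1 ≤ max p.totalDegree 1 := le_max_right _ _
  have hbpos : 1 ≤ Nat.log 2 (coeffMax p) + 1 := by omega
  rw [repSize] at hs
  set b := Nat.log 2 (coeffMax p) + 1 with hb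
  have hcard : p.support.card ≤ s := by nlinarith [Nat.mul_le_mul hcardpos hdegpos]
  have hdeg : p.totalDegree ≤ s := (le_max_left _ 1).trans (by
    nlinarith [Nat.mul_le_mul hcardpos hdegpos, Nat.mul_le_mul hdegpos hbpos])
  have hbs : b ≤ s := by nlinarith [Nat.mul_le_mul hcardpos hdegpos]
  have hs1 : 1 ≤ s := hbpos.trans hbs
  have hlog : ∀ k, k ≤ s → Nat.clog 2 k ≤ Nat.clog 2 s := fun k hk => Nat.clog_mono_right 2 hk
  let Y : (Fin m →₀ ℕ) → RatFun m := fun α =>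
    ((Finsupp.toMultiset α).toList.map fun j => polyToRat (X j)).prod
  have hterm : ∀ α ∈ p.support, Der FieldStep S
      {polyToRat (monomial α ((w α : ℚ) * p.coeff α))} (4 * Nat.clog 2 s + 6) (19 * s ^ 2) := by
    intro α hα
    have hmax : max (p.coeff α).num.natAbs (p.coeff α).den < 2 ^ b :=
      (Finset.le_sup (f := fun α => max (p.coeff α).num.natAbs (p.coeff α).den) hα).trans_lt
        (Nat.lt_pow_succ_log_self one_lt_two _)
    have e1 := Der.ratCast (K := RatFun m) h0 h1 hneg ((le_max_left _ _).trans_lt hmax)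
      ((le_max_right _ _).trans_lt hmax)
    have e2 := Der.natCast (S := S ∪ {((p.coeff α : ℚ) : RatFun m)}) (Or.inl h0) (Or.inl h1) (w α)
    have hlen : ((Finsupp.toMultiset α).toList.map
        fun j => (polyToRat (X j) : RatFun m)).length ≤ s := by
      rw [List.length_map, Multiset.length_toList, Finsupp.card_toMultiset]
      exact (le_totalDegree hα).trans hdeg
    have e3 : Der FieldStep (S ∪ {((p.coeff α : ℚ) : RatFun m)} ∪ {(w α : RatFun m)}) {Y α} _ _ :=
      (Der.list_prod (Set.mem_union_left _ (Set.mem_union_left _ h1)) _ (by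
        simp only [List.mem_map, Multiset.mem_toList, Finsupp.mem_toMultiset]
        rintro _ ⟨j, hj, rfl⟩
        exact Or.inl (Or.inl (hX j (mem_vars_iff_mem_support j |>.2 ⟨α, hα, hj⟩))))).mono (hlog _ hlen) hlen
    have e4 : Der FieldStep (S ∪ {((p.coeff α : ℚ) : RatFun m)} ∪ {(w α : RatFun m)} ∪ {Y α})
        {(w α : RatFun m) * ((p.coeff α : ℚ) : RatFun m)} 1 1 :=
      Der.step _ (.mul (Or.inl (Or.inr rfl)) (Or.inl (Or.inl (Or.inr rfl))))
    have e5 : Der FieldStep (S ∪ {((p.coeff α : ℚ) : RatFun m)} ∪ {(w α : RatFun m)} ∪ {Y α} ∪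
        {(w α : RatFun m) * ((p.coeff α : ℚ) : RatFun m)})
        {(w α : RatFun m) * ((p.coeff α : ℚ) : RatFun m) * Y α} 1 1 :=
      Der.step _ (.mul (Or.inr rfl) (Or.inl (Or.inr rfl)))
    have hmon : polyToRat (monomial α ((w α : ℚ) * p.coeff α))
        = (w α : RatFun m) * ((p.coeff α : ℚ) : RatFun m) * Y α := by
      rw [polyToRat_monomial]
      push_cast
      rfl
    rw [hmon]
    refine (e1.trans_right hmono (e2.trans_right hmono (e3.trans_right hmono
      (e4.trans_right hmono e5)))).mono ?_ ?_
    · have := hlog _ hbs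
      have := hlog _ (hw α hα)
      omega
    · have := hw α hα
      nlinarith [Nat.mul_le_mul hbs hbs]
  have e1 := Der.biUnion hmono p.support hterm
  have e2 := Der.sum (S := S ∪ ⋃ α ∈ p.support, {polyToRat (monomial α ((w α : ℚ) * p.coeff α))})
    (Or.inl h0) p.support (fun α => polyToRat (monomial α ((w α : ℚ) * p.coeff α)))
    fun α hα => Or.inr (Set.mem_biUnion (Finset.mem_coe.2 hα) rfl)
  rw [polyToRat, map_sum]
  refine (e1.trans_right hmono e2).mono ?_ ?_
  · have := hlog _ hcard
    omega
  · have h2 : 1 ≤ s ^ 2 := Nat.one_le_pow _ _ hs1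
    calc p.support.card * (19 * s ^ 2) + p.support.card
        ≤ s * (19 * s ^ 2) + s * 1 := by rw [mul_one]; gcongr
      _ ≤ s * (19 * s ^ 2) + s * s ^ 2 := by gcongr
      _ = 20 * s ^ 3 := by ring

theorem Der.poly (h0 : 0 ∈ S) (h1 : 1 ∈ S) (hneg : -1 ∈ S)
    (p : MvPolynomial (Fin m) ℚ) (hX : ∀ j ∈ p.vars, polyToRat (X j) ∈ S) {s : ℕ}
    (hs1 : 1 ≤ s) (hs : repSize p ≤ s) :
    Der FieldStep S {polyToRat p} (5 * Nat.clog 2 s + 6) (20 * s ^ 3) := by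
  have h := Der.weighted_poly h0 h1 hneg p hX hs (fun _ => 1) fun _ _ => hs1
  simpa using h

theorem Der.pderiv_poly (h0 : 0 ∈ S) (h1 : 1 ∈ S) (hneg : -1 ∈ S)
    (p : MvPolynomial (Fin m) ℚ) (hX : ∀ j ∈ p.vars, polyToRat (X j) ∈ S) {s : ℕ}
    (hs : repSize p ≤ s) (l : Fin m) (hl : polyToRat (X l) ∈ S) :
    Der FieldStep S {polyToRat (pderiv l p)} (5 * Nat.clog 2 s + 8) (20 * s ^ 3 + 2) := by
  have hmono := monoStep_fieldStep (K := RatFun m)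
  have hdeg : ∀ α ∈ p.support, α l ≤ s := by
    intro α hα
    have hα0 : 1 ≤ p.support.card := Finset.card_pos.2 ⟨α, hα⟩
    rw [repSize] at hs
    have h1 : α l ≤ max p.totalDegree 1 :=
      (Finsupp.le_degree l α).trans ((le_totalDegree hα).trans (le_max_left _ _))
    refine h1.trans (le_trans ?_ hs)
    rw [mul_right_comm]
    exact Nat.le_mul_of_pos_left _ (by positivity)
  have e1 := Der.weighted_poly h0 h1 hneg p hX hs (fun α => α l) hdeg
  have hsum : X l * pderiv l p = ∑ α ∈ p.support, monomial α ((α l : ℚ) * p.coeff α) := by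
    conv_lhs => rw [p.as_sum, map_sum, Finset.mul_sum]
    refine Finset.sum_congr rfl fun α _ => ?_
    rw [X_mul_pderiv_monomial, ← map_nsmul, nsmul_eq_mul]
  rw [← hsum] at e1
  have hne : (polyToRat (X l) : RatFun m) ≠ 0 := polyToRat_ne_zero (X_ne_zero l)
  have e2 : Der FieldStep (S ∪ {polyToRat (X l * pderiv l p)}) {(polyToRat (X l))⁻¹} 1 1 :=
    Der.step _ (.inv (Or.inl hl))
  have e3 : Der FieldStep (S ∪ {polyToRat (X l * pderiv l p)} ∪ {(polyToRat (X l))⁻¹})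
      {polyToRat (pderiv l p)} 1 1 := by
    have h : (polyToRat (pderiv l p) : RatFun m)
        = (polyToRat (X l))⁻¹ * polyToRat (X l * pderiv l p) := by
      rw [polyToRat, polyToRat, polyToRat, map_mul, inv_mul_cancel_left₀ hne]
    rw [h]
    exact Der.step _ (.mul (Or.inr rfl) (Or.inl (Or.inr rfl)))
  exact (e1.trans_right hmono (e2.trans_right hmono e3)).mono (by omega) (by omega)

end Polynomials

/-! ### Partial derivatives of rational functions -/

section PartialDerivative

variable {m : ℕ} (j : Fin m)

theorem exists_polyToRat_div (f : RatFun m) :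
    ∃ p q : MvPolynomial (Fin m) ℚ, q ≠ 0 ∧ f = polyToRat p / polyToRat q := by
  obtain ⟨p, q, hq, rfl⟩ := IsFractionRing.div_surjective (A := MvPolynomial (Fin m) ℚ) f
  exact ⟨p, q, nonZeroDivisors.ne_zero hq, rfl⟩

theorem ratPDeriv_polyToRat (p : MvPolynomial (Fin m) ℚ) :
    ratPDeriv j (polyToRat p) = polyToRat (pderiv j p) := by
  have h := ratPDeriv_div j p 1 one_ne_zero
  simpa using h

theorem ratPDeriv_add (f g : RatFun m) :
    ratPDeriv j (f + g) = ratPDeriv j f + ratPDeriv j g := by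
  obtain ⟨p, q, hq, rfl⟩ := exists_polyToRat_div f
  obtain ⟨p', q', hq', rfl⟩ := exists_polyToRat_div g
  have h : (polyToRat p / polyToRat q + polyToRat p' / polyToRat q' : RatFun m)
      = polyToRat (p * q' + q * p') / polyToRat (q * q') := by
    rw [div_add_div _ _ (polyToRat_ne_zero hq) (polyToRat_ne_zero hq')]
    simp [polyToRat]
  rw [h, ratPDeriv_div _ _ _ hq, ratPDeriv_div _ _ _ hq',
    ratPDeriv_div _ _ _ (mul_ne_zero hq hq'),
    div_add_div _ _ (polyToRat_ne_zero (pow_ne_zero 2 hq)) (polyToRat_ne_zero (pow_ne_zero 2 hq'))]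
  simp only [polyToRat, ← map_mul, ← map_add]
  congr 2
  · simp only [Derivation.leibniz, map_add, smul_eq_mul]
    ring
  · ring

theorem ratPDeriv_mul (f g : RatFun m) :
    ratPDeriv j (f * g) = ratPDeriv j f * g + f * ratPDeriv j g := by
  obtain ⟨p, q, hq, rfl⟩ := exists_polyToRat_div f
  obtain ⟨p', q', hq', rfl⟩ := exists_polyToRat_div g
  have h : (polyToRat p / polyToRat q * (polyToRat p' / polyToRat q') : RatFun m)
      = polyToRat (p * p') / polyToRat (q * q') := by
    rw [div_mul_div_comm]
    simp [polyToRat]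
  rw [h, ratPDeriv_div _ _ _ hq, ratPDeriv_div _ _ _ hq',
    ratPDeriv_div _ _ _ (mul_ne_zero hq hq'), div_mul_div_comm, div_mul_div_comm]
  have h2 : q * q' ≠ 0 := mul_ne_zero hq hq'
  have h3 : (polyToRat (q ^ 2) * polyToRat q' : RatFun m) ≠ 0 :=
    mul_ne_zero (polyToRat_ne_zero (pow_ne_zero 2 hq)) (polyToRat_ne_zero hq')
  have h4 : (polyToRat q * polyToRat (q' ^ 2) : RatFun m) ≠ 0 :=
    mul_ne_zero (polyToRat_ne_zero hq) (polyToRat_ne_zero (pow_ne_zero 2 hq'))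
  rw [div_add_div _ _ h3 h4, div_eq_div_iff (polyToRat_ne_zero (pow_ne_zero 2 h2))
    (mul_ne_zero h3 h4)]
  simp only [polyToRat, ← map_mul, ← map_add]
  congr 1
  simp only [Derivation.leibniz, smul_eq_mul]
  ring

theorem ratPDeriv_zero : ratPDeriv j (0 : RatFun m) = 0 := by
  simpa using ratPDeriv_polyToRat j 0

theorem ratPDeriv_sum {ι : Type*} (I : Finset ι) (f : ι → RatFun m) :
    ratPDeriv j (∑ i ∈ I, f i) = ∑ i ∈ I, ratPDeriv j (f i) := by
  classical
  induction I using Finset.induction_on with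
  | empty => simpa using ratPDeriv_zero j
  | insert a I ha ih => rw [Finset.sum_insert ha, Finset.sum_insert ha, ratPDeriv_add, ih]

theorem ratPDeriv_mulVec {ι : Type*} [Fintype ι] (A : Matrix ι ι (RatFun m)) (g : ι → RatFun m)
    (i : ι) : ratPDeriv j (A.mulVec g i)
      = (A.map (ratPDeriv j)).mulVec g i + A.mulVec (fun k => ratPDeriv j (g k)) i := by
  simp only [Matrix.mulVec, dotProduct, ratPDeriv_sum, ratPDeriv_mul, Finset.sum_add_distrib,
    Matrix.map_apply]

end PartialDerivative

/-! ### Value functions -/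

namespace PMC

variable {n m : ℕ} {M : PMC n m}

/-- The transition polynomials with the rows of the last two states set to zero. -/
noncomputable def polyMatrix (M : PMC n m) : Matrix (Fin n) (Fin n) (MvPolynomial (Fin m) ℚ) :=
  Matrix.of fun i j => if i.val + 2 < n then M.P i j else 0

theorem transMatrix_eq_map (M : PMC n m) :
    M.transMatrix = M.polyMatrix.map (algebraMap (MvPolynomial (Fin m) ℚ) (RatFun m)) := by
  ext i j
  simp only [transMatrix, polyMatrix, Matrix.of_apply, Matrix.map_apply]
  split_ifs <;> simp

/-- A graph-preserving valuation makes `I - A` an invertible real matrix. -/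
theorem det_ne_zero_of_graphPreserving (hM : M.Normalized) {v : Fin m → ℝ}
    (hv : M.GraphPreserving v) :
    Matrix.det (1 - M.polyMatrix.map (aeval v : MvPolynomial (Fin m) ℚ →ₐ[ℚ] ℝ)) ≠ 0 := by
  obtain ⟨hn, hreach⟩ := hM
  obtain ⟨hpos, hsum⟩ := hv
  intro hdet
  obtain ⟨y, hy0, hy⟩ := Matrix.exists_mulVec_eq_zero_iff.2 hdet
  rw [Matrix.sub_mulVec, Matrix.one_mulVec, sub_eq_zero] at hy
  have hyi : ∀ i : Fin n, y i = if i.val + 2 < n then ∑ j, aeval v (M.P i j) * y j else 0 := by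
    intro i
    conv_lhs => rw [hy]
    simp only [Matrix.mulVec, dotProduct, polyMatrix, Matrix.map_apply, Matrix.of_apply]
    split_ifs <;> simp
  have hnonneg : ∀ i j, 0 ≤ aeval v (M.P i j) := fun i j => by
    by_cases h : M.P i j = 0
    · simp [h]
    · exact (hpos i j h).1.le
  obtain ⟨i₀, -, hmax⟩ := Finset.exists_max_image Finset.univ (fun i => |y i|)
    ⟨⟨0, by omega⟩, Finset.mem_univ _⟩
  replace hmax : ∀ i, |y i| ≤ |y i₀| := fun i => hmax i (Finset.mem_univ i)
  have hi₀ : 0 < |y i₀| := by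
    obtain ⟨i, hi⟩ := Function.ne_iff.1 hy0
    exact (abs_pos.2 hi).trans_le (hmax i)
  have hedge : ∀ i j, |y i| = |y i₀| → M.Edge i j → |y j| = |y i₀| := by
    intro i j hi hij
    refine le_antisymm (hmax j) (le_of_not_gt fun hlt => ?_)
    have h := hyi i
    split_ifs at h with hin
    · have hlt' : |y i| < ∑ k, aeval v (M.P i k) * |y i₀| := by
        calc |y i| ≤ ∑ k, |aeval v (M.P i k) * y k| := by
              rw [h]; exact Finset.abs_sum_le_sum_abs _ _
          _ = ∑ k, aeval v (M.P i k) * |y k| :=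
              Finset.sum_congr rfl fun k _ => by rw [abs_mul, abs_of_nonneg (hnonneg i k)]
          _ < ∑ k, aeval v (M.P i k) * |y i₀| :=
              Finset.sum_lt_sum (fun k _ => mul_le_mul_of_nonneg_left (hmax k) (hnonneg i k))
                ⟨j, Finset.mem_univ j, mul_lt_mul_of_pos_left hlt (hpos i j hij).1⟩
      rw [← Finset.sum_mul, hsum, one_mul, hi] at hlt'
      exact lt_irrefl _ hlt'
    · rw [h, abs_zero] at hi
      exact hi₀.ne hi
  have hzero : ∀ i : Fin n, ¬ i.val + 2 < n → |y i| ≠ |y i₀| := fun i hi h => by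
    rw [hyi i, if_neg hi, abs_zero] at h
    exact hi₀.ne h
  by_cases hlast : i₀ = ⟨n - 2, by omega⟩
  · exact hzero i₀ (by rw [hlast]; simp only; omega) rfl
  · have hpath := not_not.1 (mt (hreach i₀).1 hlast)
    refine hzero ⟨n - 1, by omega⟩ (by simp only; omega) ?_
    generalize (⟨n - 1, by omega⟩ : Fin n) = t at hpath
    induction hpath with
    | refl => rfl
    | tail _ hbc ih => exact hedge _ _ ih hbc

theorem det_one_sub_transMatrix_ne_zero (hM : M.Normalized)
    (hv : ∃ v : Fin m → ℝ, M.GraphPreserving v) : Matrix.det (1 - M.transMatrix) ≠ 0 := by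
  obtain ⟨v, hv⟩ := hv
  have h := det_ne_zero_of_graphPreserving hM hv
  have h1 : (1 : Matrix (Fin n) (Fin n) ℝ) - M.polyMatrix.map (aeval v)
      = (1 - M.polyMatrix).map (aeval v : MvPolynomial (Fin m) ℚ →ₐ[ℚ] ℝ) := by
    rw [Matrix.map_sub _ (map_sub _), Matrix.map_one _ (map_zero _) (map_one _)]
  have h2 : (1 : Matrix (Fin n) (Fin n) (RatFun m)) - M.transMatrix
      = (1 - M.polyMatrix).map (algebraMap (MvPolynomial (Fin m) ℚ) (RatFun m)) := by
    rw [transMatrix_eq_map, Matrix.map_sub _ (map_sub _),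
      Matrix.map_one _ (map_zero _) (map_one _)]
  rw [h1, ← AlgHom.mapMatrix_apply, ← AlgHom.map_det] at h
  rw [h2, ← RingHom.mapMatrix_apply, ← RingHom.map_det]
  exact polyToRat_ne_zero fun h0 => h (by rw [h0, map_zero])

/-- The vector `(0, …, 0, 1)`. -/
noncomputable def targetVec (n m : ℕ) : Fin n → RatFun m := fun i => if i.val + 1 = n then 1 else 0

theorem isValueFunctions_iff (h : Matrix.det (1 - M.transMatrix) ≠ 0) (g : Fin n → RatFun m) :
    M.IsValueFunctions g ↔ g = (1 - M.transMatrix)⁻¹.mulVec (targetVec n m) := by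
  have hu : IsUnit (1 - M.transMatrix).det := h.isUnit
  constructor
  · intro hg
    have hg' : targetVec n m = (1 - M.transMatrix).mulVec g := Eq.symm hg
    rw [hg', Matrix.mulVec_mulVec, Matrix.nonsing_inv_mul _ hu, Matrix.one_mulVec]
  · rintro rfl
    rw [IsValueFunctions, Matrix.mulVec_mulVec, Matrix.mul_nonsing_inv _ hu, Matrix.one_mulVec]
    rfl

theorem IsValueFunctions.ratPDeriv_eq (h : Matrix.det (1 - M.transMatrix) ≠ 0)
    {g : Fin n → RatFun m} (hg : M.IsValueFunctions g) (j : Fin m) :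
    (fun i => ratPDeriv j (g i))
      = (1 - M.transMatrix)⁻¹.mulVec ((M.transMatrix.map (ratPDeriv j)).mulVec g) := by
  have hu : IsUnit (1 - M.transMatrix).det := h.isUnit
  have hconst : ∀ i : Fin n, ratPDeriv j (if i.val + 1 = n then (1 : RatFun m) else 0) = 0 := by
    intro i
    split_ifs
    · simpa using ratPDeriv_polyToRat j 1
    · exact ratPDeriv_zero j
  have key : (1 - M.transMatrix).mulVec (fun i => ratPDeriv j (g i))
      = (M.transMatrix.map (ratPDeriv j)).mulVec g := by
    rw [IsValueFunctions, Matrix.sub_mulVec, Matrix.one_mulVec, sub_eq_iff_eq_add] at hg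
    rw [Matrix.sub_mulVec, Matrix.one_mulVec, sub_eq_iff_eq_add]
    ext i
    have hi := congrArg (ratPDeriv j) (congrFun hg i)
    rw [Pi.add_apply, ratPDeriv_add, hconst, zero_add, ratPDeriv_mulVec] at hi
    exact hi
  rw [← key, Matrix.mulVec_mulVec, Matrix.nonsing_inv_mul _ hu, Matrix.one_mulVec]

end PMC

/-! ### Size and depth bounds -/

theorem card_vars_le_repSize {m : ℕ} (p : MvPolynomial (Fin m) ℚ) : p.vars.card ≤ repSize p := by
  classical
  have hsub : p.vars ⊆ p.support.biUnion Finsupp.support := fun j hj => by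
    obtain ⟨α, hα, hj⟩ := (mem_vars_iff_mem_support j).1 hj
    exact Finset.mem_biUnion.2 ⟨α, hα, hj⟩
  have hcard : ∀ α ∈ p.support, α.support.card ≤ max p.totalDegree 1 := fun α hα =>
    calc α.support.card = ∑ j ∈ α.support, 1 := by simp
      _ ≤ ∑ j ∈ α.support, α j :=
        Finset.sum_le_sum fun j hj => Nat.one_le_iff_ne_zero.2 (Finsupp.mem_support_iff.1 hj)
      _ ≤ max p.totalDegree 1 := (le_totalDegree hα).trans (le_max_left _ _)
  calc p.vars.card ≤ (p.support.biUnion Finsupp.support).card := Finset.card_le_card hsub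
    _ ≤ p.support.card * max p.totalDegree 1 := Finset.card_biUnion_le_card_mul _ _ _ hcard
    _ ≤ repSize p := Nat.le_mul_of_pos_right _ (Nat.succ_pos _)

theorem one_le_repSize {m : ℕ} {p : MvPolynomial (Fin m) ℚ} (hp : p ≠ 0) : 1 ≤ repSize p := by
  have h : 0 < p.support.card := Finset.card_pos.2 (support_nonempty.2 hp)
  exact Nat.succ_le_of_lt (by rw [repSize]; positivity)

namespace PMC

variable {n m : ℕ} (M : PMC n m)

theorem repSize_le_size (i j : Fin n) : repSize (M.P i j) ≤ M.size :=
  (Finset.single_le_sum (f := fun j => repSize (M.P i j)) (fun _ _ => Nat.zero_le _)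
    (Finset.mem_univ j)).trans
  (Finset.single_le_sum (f := fun i => ∑ j, repSize (M.P i j)) (fun _ _ => Nat.zero_le _)
    (Finset.mem_univ i))

theorem le_size {v : Fin m → ℝ} (hv : M.GraphPreserving v) : n ≤ M.size := by
  have hrow : ∀ i ∈ Finset.univ, 1 ≤ ∑ j, repSize (M.P i j) := by
    intro i _
    obtain ⟨j, hj⟩ : ∃ j, M.P i j ≠ 0 := by
      by_contra! h
      simpa [h] using hv.2 i
    exact (one_le_repSize hj).trans (Finset.single_le_sum (f := fun j => repSize (M.P i j))
      (fun _ _ => Nat.zero_le _) (Finset.mem_univ j))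
  simpa [size] using Finset.card_nsmul_le_sum Finset.univ _ 1 hrow

open scoped Classical in
/-- The parameters that occur in the chain. -/
noncomputable def usedVars : Finset (Fin m) :=
  Finset.univ.biUnion fun i => Finset.univ.biUnion fun j => (M.P i j).vars

theorem mem_usedVars {l : Fin m} : l ∈ M.usedVars ↔ ∃ i j, l ∈ (M.P i j).vars := by
  simp [usedVars]

theorem card_usedVars_le : M.usedVars.card ≤ M.size :=
  Finset.card_biUnion_le.trans (Finset.sum_le_sum fun _ _ =>
    Finset.card_biUnion_le.trans (Finset.sum_le_sum fun _ _ => card_vars_le_repSize _))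

open scoped Classical in
/-- The input gates: the parameters that occur, and the constants. -/
noncomputable def inputs : Finset (MvPolynomial (Fin m) ℚ) :=
  M.usedVars.image X ∪ {0, 1, -1}

theorem card_inputs_le : M.inputs.card ≤ M.size + 3 := by
  classical
  exact (Finset.card_union_le _ _).trans (add_le_add
    (Finset.card_image_le.trans M.card_usedVars_le) Finset.card_le_three)

theorem eq_var_or_const_of_mem_inputs {x : MvPolynomial (Fin m) ℚ} (hx : x ∈ M.inputs) :
    (∃ i, x = X i) ∨ ∃ c : SignType, x = (c : MvPolynomial (Fin m) ℚ) := by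
  simp only [inputs, Finset.mem_union, Finset.mem_image, Finset.mem_insert,
    Finset.mem_singleton] at hx
  rcases hx with ⟨i, -, rfl⟩ | rfl | rfl | rfl
  · exact Or.inl ⟨i, rfl⟩
  · exact Or.inr ⟨0, by simp⟩
  · exact Or.inr ⟨1, by simp⟩
  · exact Or.inr ⟨-1, by simp⟩

theorem map_ratPDeriv_transMatrix (l : Fin m) (i j : Fin n) :
    M.transMatrix.map (ratPDeriv l) i j
      = if i.val + 2 < n then polyToRat (pderiv l (M.P i j)) else 0 := by
  rw [Matrix.map_apply, transMatrix, Matrix.of_apply]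
  split_ifs
  · exact ratPDeriv_polyToRat _ _
  · exact ratPDeriv_zero _

theorem der_valueFunctions (hn : 2 ≤ n) (hns : n ≤ M.size)
    (hdet : Matrix.det (1 - M.transMatrix) ≠ 0) {g : Fin n → RatFun m}
    (hg : M.IsValueFunctions g) :
    Der FieldStep (polyToRat '' (M.inputs : Set (MvPolynomial (Fin m) ℚ)))
      (Set.range g ∪ Set.range fun p : Fin m × Fin n => ratPDeriv p.1 (g p.2))
      (5 * Nat.clog 2 M.size + 8 + 20 * (1 + Nat.clog 2 (n + 1)) ^ 2 + 2 * (1 + Nat.clog 2 n))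
      (3300 * M.size ^ 6) := by
  classical
  have hmono := monoStep_fieldStep (K := RatFun m)
  set s := M.size with hs
  set S : Set (RatFun m) := polyToRat '' (M.inputs : Set (MvPolynomial (Fin m) ℚ)) with hS
  have hs1 : 1 ≤ s := by omega
  have h0 : 0 ∈ S := ⟨0, by simp [inputs], by simp⟩
  have h1 : 1 ∈ S := ⟨1, by simp [inputs], by simp⟩
  have hneg : -1 ∈ S := ⟨-1, by simp [inputs], by simp⟩
  have hX : ∀ l ∈ M.usedVars, polyToRat (X l) ∈ S := fun l hl =>
    ⟨X l, by simp [inputs, hl], rfl⟩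
  have hXP : ∀ i j, ∀ l ∈ (M.P i j).vars, polyToRat (X l) ∈ S := fun i j l hl =>
    hX l (M.mem_usedVars.2 ⟨i, j, hl⟩)
  let W := (1 - M.transMatrix)⁻¹
  let D : Fin m → Matrix (Fin n) (Fin n) (RatFun m) := fun l => M.transMatrix.map (ratPDeriv l)
  let T1 : Set (RatFun m) := Set.range (fun p : Fin n × Fin n => polyToRat (M.P p.1 p.2)) ∪
    ⋃ l ∈ M.usedVars, Set.range fun p : Fin n × Fin n => polyToRat (pderiv l (M.P p.1 p.2))
  let T3 : Set (RatFun m) := ⋃ l ∈ M.usedVars, Set.range ((D l).mulVec g)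
  let T4 : Set (RatFun m) := ⋃ l ∈ M.usedVars, Set.range (W.mulVec ((D l).mulVec g))
  have hP : ∀ i j, polyToRat (M.P i j) ∈ T1 := fun i j => Or.inl ⟨(i, j), rfl⟩
  have hD : ∀ l ∈ M.usedVars, ∀ i j, polyToRat (pderiv l (M.P i j)) ∈ T1 := fun l hl i j =>
    Or.inr (Set.mem_biUnion (Finset.mem_coe.2 hl) ⟨(i, j), rfl⟩)
  have d1 : Der FieldStep S T1 (5 * Nat.clog 2 s + 8)
      (n * n * (20 * s ^ 3) + M.usedVars.card * (n * n * (20 * s ^ 3 + 2))) := by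
    refine Der.union hmono ?_ (Der.biUnion hmono _ fun l hl => ?_)
    · exact (Der.range hmono (c := 20 * s ^ 3) (d := 5 * Nat.clog 2 s + 6) fun p =>
        Der.poly h0 h1 hneg _ (hXP _ _) hs1 (M.repSize_le_size _ _)).mono (by omega) (by simp)
    · exact (Der.range hmono (c := 20 * s ^ 3 + 2) (d := 5 * Nat.clog 2 s + 8) fun p =>
        Der.pderiv_poly h0 h1 hneg _ (hXP _ _) (M.repSize_le_size _ _) l (hX l hl)).mono
          le_rfl (by simp)
  have d2 : Der FieldStep (S ∪ T1) (matrixEntries W) (20 * (1 + Nat.clog 2 (n + 1)) ^ 2)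
      (100 * (n + 1) ^ 5) := by
    refine Der.matrix_inv (Set.mem_union_left _ h0) (Set.mem_union_left _ h1)
      (Set.mem_union_left _ hneg) ?_ hdet
    rw [matrixEntries_subset]
    intro i j
    rw [transMatrix, Matrix.of_apply]
    split_ifs
    · exact Or.inr (hP i j)
    · exact Or.inl h0
  have hgW : ∀ i, g i ∈ matrixEntries W := by
    intro i
    refine ⟨(i, ⟨n - 1, by omega⟩), ?_⟩
    rw [(isValueFunctions_iff hdet g).1 hg, Matrix.mulVec, dotProduct, Finset.sum_eq_single
      (⟨n - 1, by omega⟩ : Fin n)]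
    · have : n - 1 + 1 = n := by omega
      simp [targetVec, this, W]
    · intro k _ hk
      have : k.val + 1 ≠ n := fun h => hk (Fin.ext (by simp only; omega))
      simp [targetVec, this]
    · simp
  have d3 : Der FieldStep (S ∪ T1 ∪ matrixEntries W) T3 (1 + Nat.clog 2 n)
      (M.usedVars.card * (n * (2 * n))) := by
    refine Der.biUnion hmono _ fun l hl => ?_
    refine (Der.mulVec (Set.mem_union_left _ (Set.mem_union_left _ h0)) (fun i k => ?_)
      fun k => ?_).mono (by simp) (by simp)
    · have := M.map_ratPDeriv_transMatrix l i k
      dsimp only [D]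
      rw [this]
      split_ifs
      · exact Or.inl (Or.inr (hD l hl i k))
      · exact Or.inl (Or.inl h0)
    · exact Or.inr (hgW k)
  have d4 : Der FieldStep (S ∪ T1 ∪ matrixEntries W ∪ T3) T4 (1 + Nat.clog 2 n)
      (M.usedVars.card * (n * (2 * n))) := by
    refine Der.biUnion hmono _ fun l hl => ?_
    refine (Der.mulVec (Set.mem_union_left _ (Set.mem_union_left _ (Set.mem_union_left _ h0)))
      (fun i k => ?_) fun k => ?_).mono (by simp) (by simp)
    · exact Or.inl (Or.inr ⟨(i, k), rfl⟩)
    · exact Or.inr (Set.mem_biUnion (Finset.mem_coe.2 hl) ⟨k, rfl⟩)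
  have dall := (d1.trans_right hmono (d2.trans hmono (d3.trans_right hmono d4)))
  have hbase : Der FieldStep S S 0 0 := Der.of_subset subset_rfl
  refine ((dall.union hmono (hbase.mono (Nat.zero_le _) le_rfl)).subset ?_).mono (by omega) ?_
  · refine Set.union_subset ?_ ?_
    · rintro _ ⟨i, rfl⟩
      exact Or.inl (Or.inl (hgW i))
    · rintro _ ⟨⟨l, i⟩, rfl⟩
      have h := congrFun (hg.ratPDeriv_eq hdet l) i
      dsimp only at h ⊢
      rw [h]
      by_cases hl : l ∈ M.usedVars
      · exact Or.inl (Or.inr (Set.mem_biUnion (Finset.mem_coe.2 hl) ⟨i, rfl⟩))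
      · have hzero : M.transMatrix.map (ratPDeriv l) = 0 := by
          ext i j
          rw [map_ratPDeriv_transMatrix, pderiv_eq_zero_of_notMem_vars
            fun hmem => hl (M.mem_usedVars.2 ⟨i, j, hmem⟩)]
          simp
        rw [hzero, Matrix.zero_mulVec, Matrix.mulVec_zero]
        exact Or.inr h0
  · have hu := M.card_usedVars_le
    rw [← hs] at hu
    have p2 : 1 ≤ s ^ 3 := Nat.one_le_pow _ _ hs1
    have p3 : s ^ 3 ≤ s ^ 6 := Nat.pow_le_pow_right hs1 (by omega)
    have p5 : s ^ 5 ≤ s ^ 6 := Nat.pow_le_pow_right hs1 (by omega)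
    have q1 : n * n * (20 * s ^ 3) ≤ 20 * s ^ 5 := by
      calc n * n * (20 * s ^ 3) ≤ s * s * (20 * s ^ 3) := by gcongr
        _ = 20 * s ^ 5 := by ring
    have q2 : M.usedVars.card * (n * n * (20 * s ^ 3 + 2)) ≤ 22 * s ^ 6 := by
      calc M.usedVars.card * (n * n * (20 * s ^ 3 + 2))
          ≤ s * (s * s * (20 * s ^ 3 + 2 * s ^ 3)) := by gcongr; omega
        _ = 22 * s ^ 6 := by ring
    have q3 : 100 * (n + 1) ^ 5 ≤ 3200 * s ^ 5 := by
      calc 100 * (n + 1) ^ 5 ≤ 100 * (2 * s) ^ 5 := by gcongr; omega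
        _ = 3200 * s ^ 5 := by ring
    have q4 : M.usedVars.card * (n * (2 * n)) ≤ 2 * s ^ 3 := by
      calc M.usedVars.card * (n * (2 * n)) ≤ s * (s * (2 * s)) := by gcongr
        _ = 2 * s ^ 3 := by ring
    omega

end PMC

theorem clog_two_le_logb (k : ℕ) : (Nat.clog 2 k : ℝ) ≤ Real.logb 2 k + 1 := by
  rcases Nat.eq_zero_or_pos k with rfl | hk
  · simp
  · have h := Real.natCeil_logb_natCast 2 k
    rw [← h]
    refine (Nat.ceil_lt_add_one (Real.logb_nonneg (by norm_num) ?_)).le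
    exact_mod_cast hk

theorem depth_bound {n s d : ℕ} {N : ℝ} (hn : 2 ≤ n) (hns : n ≤ s) (hN : (n : ℝ) ≤ N)
    (hd : d ≤ 2 * (5 * Nat.clog 2 s + 8 + 20 * (1 + Nat.clog 2 (n + 1)) ^ 2
      + 2 * (1 + Nat.clog 2 n))) :
    (d : ℝ) ≤ (700 : ℕ) * Real.logb 2 s * Real.logb 2 N := by
  have hn' : (2 : ℝ) ≤ n := by exact_mod_cast hn
  have hns' : (n : ℝ) ≤ s := by exact_mod_cast hns
  have hx1 : 1 ≤ Real.logb 2 n := by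
    rw [Real.le_logb_iff_rpow_le (by norm_num) (by linarith)]
    simpa using hn'
  have hxs : Real.logb 2 n ≤ Real.logb 2 s :=
    Real.logb_le_logb_of_le (by norm_num) (by linarith) hns'
  have hxN : Real.logb 2 n ≤ Real.logb 2 N :=
    Real.logb_le_logb_of_le (by norm_num) (by linarith) hN
  have hs := clog_two_le_logb s
  have hnn := clog_two_le_logb n
  have hn1 : (Nat.clog 2 (n + 1) : ℝ) ≤ 3 * Real.logb 2 n := by
    have h : Nat.clog 2 (n + 1) ≤ Nat.clog 2 n + 1 := by
      refine Nat.clog_le_of_le_pow ?_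
      have := Nat.le_pow_clog one_lt_two n
      rw [pow_succ]
      omega
    have h' : (Nat.clog 2 (n + 1) : ℝ) ≤ Nat.clog 2 n + 1 := by exact_mod_cast h
    linarith
  have hd' : (d : ℝ) ≤ 2 * (5 * Nat.clog 2 s + 8 + 20 * (1 + Nat.clog 2 (n + 1)) ^ 2
      + 2 * (1 + Nat.clog 2 n)) := by exact_mod_cast hd
  generalize Real.logb 2 (n : ℝ) = x at *
  generalize Real.logb 2 (s : ℝ) = y at *
  generalize Real.logb 2 N = z at *
  have hsq : (1 + (Nat.clog 2 (n + 1) : ℝ)) ^ 2 ≤ 16 * (y * z) := by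
    calc (1 + (Nat.clog 2 (n + 1) : ℝ)) ^ 2 ≤ (4 * x) ^ 2 := by
          gcongr
          linarith
      _ = 16 * (x * x) := by ring
      _ ≤ 16 * (y * z) := by
          have := mul_le_mul hxs hxN (by linarith) (by linarith)
          linarith
  have hy : y ≤ y * z := le_mul_of_one_le_right (by linarith) (by linarith)
  have hz : z ≤ y * z := le_mul_of_one_le_left (by linarith) (by linarith)
  push_cast
  rw [mul_assoc]
  linarith

theorem mainTheorem4 :
    ∃ K : ℕ, ∀ (n m : ℕ) (M : PMC n m), M.Normalized →
      (∃ v : Fin m → ℝ, M.GraphPreserving v) →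
      ∃ g : Fin n → RatFun m,
        (M.IsValueFunctions g ∧ ∀ g' : Fin n → RatFun m, M.IsValueFunctions g' → g' = g) ∧
        ∃ N D : Fin n → Circuit m (m + 1), ∀ i : Fin n,
          (N i).size ≤ M.size ^ K ∧
          (D i).size ≤ M.size ^ K ∧
          ((N i).depth : ℝ) ≤
            K * Real.logb 2 M.size * Real.logb 2 ((n : ℝ) * max (M.maxDegree : ℝ) 1) ∧
          ((D i).depth : ℝ) ≤
            K * Real.logb 2 M.size * Real.logb 2 ((n : ℝ) * max (M.maxDegree : ℝ) 1) ∧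
          (∀ l : Fin (m + 1), (D i).outputs l ≠ 0) ∧
          polyToRat ((N i).outputs 0) / polyToRat ((D i).outputs 0) = g i ∧
          ∀ j : Fin m,
            polyToRat ((N i).outputs j.succ) / polyToRat ((D i).outputs j.succ)
              = ratPDeriv j (g i) := by
  refine ⟨700, fun n m M hM hv => ?_⟩
  have hdet := PMC.det_one_sub_transMatrix_ne_zero hM hv
  obtain ⟨hn, -⟩ := hM
  obtain ⟨v, hv⟩ := hv
  have hns := M.le_size hv
  have hg := (PMC.isValueFunctions_iff hdet _).2 rfl
  have hder := M.der_valueFunctions hn hns hdet hg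
  refine ⟨_, ⟨hg, fun g' hg' => (PMC.isValueFunctions_iff hdet g').1 hg'⟩, ?_⟩
  generalize (1 - M.transMatrix)⁻¹.mulVec (PMC.targetVec n m) = g at hder
  obtain ⟨N, D, hND⟩ := Circuit.exists_of_der (k := m + 1) M.inputs
    (fun x hx => M.eq_var_or_const_of_mem_inputs hx) (by simp [PMC.inputs])
    (by simp [PMC.inputs]) hder
    (fun i => Fin.cons (g i) fun l => ratPDeriv l (g i)) (fun i l => by
      cases l using Fin.cases with
      | zero => exact Or.inl ⟨i, rfl⟩
      | succ l => exact Or.inr ⟨(l, i), rfl⟩)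
  have hs2 : 2 ≤ M.size := hn.trans hns
  have hsize : M.inputs.card + 4 * (3300 * M.size ^ 6) ≤ M.size ^ 700 := by
    have h1 := M.card_inputs_le
    have h2 : M.size ≤ M.size ^ 6 := Nat.le_self_pow (by norm_num) _
    have h3 : 1 ≤ M.size ^ 6 := Nat.one_le_pow _ _ (by omega)
    calc M.inputs.card + 4 * (3300 * M.size ^ 6) ≤ 2 ^ 14 * M.size ^ 6 := by omega
      _ ≤ M.size ^ 14 * M.size ^ 6 := by gcongr
      _ = M.size ^ 20 := by rw [← pow_add]
      _ ≤ M.size ^ 700 := pow_le_pow_right₀ (by omega) (by norm_num)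
  have hnd : (n : ℝ) ≤ (n : ℝ) * max (M.maxDegree : ℝ) 1 :=
    le_mul_of_one_le_right (Nat.cast_nonneg n) (le_max_right _ _)
  refine ⟨N, D, fun i => ?_⟩
  obtain ⟨hN, hD, hNd, hDd, hout⟩ := hND i
  exact ⟨hN.trans hsize, hD.trans hsize, depth_bound hn hns hnd hNd, depth_bound hn hns hnd hDd,
    fun l => (hout l).1, (hout 0).2, fun j => (hout j.succ).2⟩
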